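/- **Lemma 1 (Modular Reduction in Constant Depth).** For natural numbers $x,y,z$ let $\mathrm{csa}(x,y,z)=(s,t)$, where $s$ is the bitwise parity of $x,y,z$ and $t$ is twice their bitwise majority, so that $s+t=x+y+z$. Let $n,m$ be natural numbers with $0<m<2^n$ (an $n$-bit modulus), and let $0\le a,b,c<2^{n+2}$ (numbers held in $(n+2)$-bit registers). Write $w_i$ for the bit of significance $2^i$ of $w$. Define four carry-save layers by $$(u,v)=\mathrm{csa}(a,b,c),\qquad (u',v')=\mathrm{csa}\bigl(u\bmod 2^{n+1},\;v\bmod 2^{n+1},\;v_{n+1}\cdot(2^{n+1}\bmod m)\bigr),$$ $$(u'',v'')=\mathrm{csa}\bigl(u',v',u_{n+1}\cdot(2^{n+1}\bmod m)\bigr),\qquad (u''',v''')=\mathrm{csa}\bigl(u'',v'',v_{n+2}\cdot(2^{n+2}\bmod m)\bigr);$$ that is, one layer of non-modular addition, truncation of the overflow bits $u_{n+1},v_{n+1},v_{n+2}$, and three layers that add back their residues modulo $m$, controlled on these bits. Then: 1. $u<2^{n+2}$ and $v<2^{n+3}$; no new overflow bit arises, i.e. $u',v',u'',v'',u''',v'''<2^{n+2}$;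 $v'''$ is even; and $u'''+v'''\equiv a+b+c \pmod m$. 2. There is a polynomial $P$ such that for all $n$ and $m$ with $0<m<2^n$ there is a circuit in 2D CCNTC (depending only on $n$ and $m$) of depth at most $374$, size at most $551n+757$ on every run, and width at most $33n+47$, whose classical controller evaluates Boolean expressions of total size at most $P(n)$, and which, for every sequence of measurement outcomes, acts up to a scalar factor independent of $a,b,c$ as $$|a\rangle|b\rangle|c\rangle|0\rangle|0\rangle\;\longmapsto\;|a\rangle|b\rangle|c\rangle|u'''\rangle|v'''\rangle\qquad(0\le a,b,c<2^{n+2})$$ on five disjoint $(n+2)$-qubit registers, all other qubits starting and ending in $|0\rangle$ (so it also does so on superpositions of inputs). Moreover there are times $t_1<t_2<t_3<t_4$, at most the depth, after which $(u,v)$, $(u',v')$, $(u'',v'')$, $(u''',v''')$, respectively, are held with certainty in registers of qubits, for every input $a,b,c$ and all outcomes. Here a *2D CCNTC circuit* consists of finitely many qubits placed in the plane at mutual distance at least $1$; an interaction graph on them of maximum degree at most $6$, drawn with straight, non-crossing edges of length at most $2$; and a sequence of timesteps. In each timestep a deterministic classical controller selects, as a function of the outcomes of measurements in earlier timesteps,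 gates from $\{X,Z,H,T,T^\dagger,\mathrm{CNOT},\mathrm{MeasureZ}\}$ that act on pairwise disjoint sets of qubits, CNOT only along edges of the graph. The *depth* is the number of timesteps, the *size* the total number of gates applied, and the *width* the number of qubits that some gate operates upon, together with the input and output qubits. -/

import Mathlib

noncomputable section

namespace CCNTC

/-! ### Carry-save arithmetic -/

/-- Bitwise carry-save addition of three numbers: the word of the sum bits (parities) and the word
of the carry bits (majorities), the latter shifted by one position. -/
def csa (x y z : ℕ) : ℕ × ℕ :=
  (x ^^^ y ^^^ z, 2 * ((x &&& y) ||| (x &&& z) ||| (y &&& z)))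

/-- The bit of significance `2 ^ i` of `x`, as a number. -/
def bit (x i : ℕ) : ℕ := (x.testBit i).toNat

/-- Layer 1: the non-modular carry-save sum `(u, v)` of the three inputs. -/
def layer1 (a b c : ℕ) : ℕ × ℕ := csa a b c

/-- Layer 2: drop the bits `n + 1` of `u` and `n + 1`, `n + 2` of `v`, and add back
`2 ^ (n + 1) mod m`, controlled on the dropped bit `n + 1` of `v`. -/
def layer2 (n m a b c : ℕ) : ℕ × ℕ :=
  csa ((layer1 a b c).1 % 2 ^ (n + 1)) ((layer1 a b c).2 % 2 ^ (n + 1))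
    (bit (layer1 a b c).2 (n + 1) * (2 ^ (n + 1) % m))

/-- Layer 3: add back `2 ^ (n + 1) mod m`, controlled on the dropped bit `n + 1` of `u`. -/
def layer3 (n m a b c : ℕ) : ℕ × ℕ :=
  csa (layer2 n m a b c).1 (layer2 n m a b c).2
    (bit (layer1 a b c).1 (n + 1) * (2 ^ (n + 1) % m))

/-- Layer 4: add back `2 ^ (n + 2) mod m`, controlled on the dropped bit `n + 2` of `v`. -/
def layer4 (n m a b c : ℕ) : ℕ × ℕ :=
  csa (layer3 n m a b c).1 (layer3 n m a b c).2
    (bit (layer1 a b c).2 (n + 2) * (2 ^ (n + 2) % m))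

/-! ### Qubits in the plane -/

/-- A planar arrangement of qubits: a drawing of the interaction graph in the plane with straight
edges that do not cross, at most six neighbours for each qubit, and edges at most twice as long as
the unit spacing that separates the qubits. -/
structure Layout (V : Type) [Fintype V] where
  graph : SimpleGraph V
  pos : V → EuclideanSpace ℝ (Fin 2)
  separated : ∀ u v, u ≠ v → 1 ≤ dist (pos u) (pos v)
  edge_length : ∀ u v, graph.Adj u v → dist (pos u) (pos v) ≤ 2
  vertex_off_edge : ∀ u v w, graph.Adj u v → pos w ∈ segment ℝ (pos u) (pos v) → w = u ∨ w = v
  no_crossing : ∀ u v x y, graph.Adj u v → graph.Adj x y → s(u, v) ≠ s(x, y) →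
    Disjoint (openSegment ℝ (pos u) (pos v)) (openSegment ℝ (pos x) (pos y))
  degree_le : ∀ v, (graph.neighborSet v).ncard ≤ 6

/-! ### Gates -/

/-- The elementary gates. -/
inductive Gate (V : Type) where
  | X (v : V) : Gate V
  | Z (v : V) : Gate V
  | H (v : V) : Gate V
  | T (v : V) : Gate V
  | Tdg (v : V) : Gate V
  | CNOT (control target : V) : Gate V
  | MeasureZ (v : V) : Gate V

/-- The qubits a gate acts on. -/
def Gate.qubits {V : Type} : Gate V → List V
  | .X v => [v]
  | .Z v => [v]
  | .H v => [v]
  | .T v => [v]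
  | .Tdg v => [v]
  | .CNOT u v => [u, v]
  | .MeasureZ v => [v]

/-- Two-qubit gates act along edges of the interaction graph. -/
def Gate.Allowed {V : Type} (G : SimpleGraph V) : Gate V → Prop
  | .CNOT u v => G.Adj u v
  | _ => True

/-- (Unnormalised) pure states, by their amplitudes in the computational basis. -/
abbrev State (V : Type) : Type := (V → Bool) → ℂ

/-- Computational basis states. -/
def ket {V : Type} (y : V → Bool) : State V :=
  open Classical in fun x => if x = y then 1 else 0

/-- The action of a gate on amplitudes. The argument `o` tells which outcome a measurement has;
a measurement acts as the projection onto that outcome, without normalisation, so that the squared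
norm of the resulting state is the probability of the branch. -/
def Gate.act {V : Type} [DecidableEq V] (o : V → Bool) : Gate V → State V → State V
  | .X v, ψ => fun x => ψ (Function.update x v (!x v))
  | .Z v, ψ => fun x => (if x v then -1 else 1) * ψ x
  | .H v, ψ => fun x => ((Real.sqrt 2 : ℝ) : ℂ)⁻¹ *
      (ψ (Function.update x v false) + (if x v then -1 else 1) * ψ (Function.update x v true))
  | .T v, ψ => fun x => (if x v then Complex.exp (Complex.I * (Real.pi / 4)) else 1) * ψ x
  | .Tdg v, ψ => fun x => (if x v then Complex.exp (-(Complex.I * (Real.pi / 4))) else 1) * ψ x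
  | .CNOT u v, ψ => fun x => ψ (Function.update x v (xor (x v) (x u)))
  | .MeasureZ v, ψ => fun x => if x v = o v then ψ x else 0

/-! ### The classical controller and the circuits -/

/-- The measurement outcomes of a run: `r t v` is the outcome of the measurement of the qubit `v`
in timestep `t`. -/
abbrev Record (V : Type) : Type := ℕ → V → Bool

/-- Boolean expressions in the measurement outcomes, evaluated by the classical controller. -/
inductive Cond (V : Type) where
  | const (b : Bool) : Cond V
  | outcome (t : ℕ) (v : V) : Cond V
  | neg (p : Cond V) : Cond V
  | conj (p q : Cond V) : Cond V
  | parity (p q : Cond V) : Cond V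

/-- The value of an expression. -/
def Cond.eval {V : Type} (r : Record V) : Cond V → Bool
  | .const b => b
  | .outcome t v => r t v
  | .neg p => !p.eval r
  | .conj p q => p.eval r && q.eval r
  | .parity p q => xor (p.eval r) (q.eval r)

/-- The number of nodes of an expression: the cost of its evaluation. -/
def Cond.size {V : Type} : Cond V → ℕ
  | .const _ => 1
  | .outcome _ _ => 1
  | .neg p => p.size + 1
  | .conj p q => p.size + q.size + 1
  | .parity p q => p.size + q.size + 1

/-- Only outcomes of timesteps before `t` are read. -/
def Cond.ReadsBefore {V : Type} (t : ℕ) : Cond V → Prop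
  | .const _ => True
  | .outcome s _ => s < t
  | .neg p => p.ReadsBefore t
  | .conj p q => p.ReadsBefore t ∧ q.ReadsBefore t
  | .parity p q => p.ReadsBefore t ∧ q.ReadsBefore t

/-- A gate together with the condition under which the classical controller applies it. -/
structure Instr (V : Type) where
  cond : Cond V
  gate : Gate V

/-- The gates that are applied in a timestep. -/
def fired {V : Type} (r : Record V) (l : List (Instr V)) : List (Gate V) :=
  (l.filter fun i => i.cond.eval r).map Instr.gate

/-- A circuit of concurrent nearest-neighbour gates in the plane with a classical controller:
in each timestep the controller selects gates by means of earlier outcomes; the selected gates act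
on pairwise disjoint (sets of) qubits and along edges. -/
structure Circuit (V : Type) [Fintype V] extends Layout V where
  steps : List (List (Instr V))
  allowed : ∀ l ∈ steps, ∀ i ∈ l, i.gate.Allowed graph
  causal : ∀ (t : ℕ) (l : List (Instr V)), steps[t]? = some l → ∀ i ∈ l, i.cond.ReadsBefore t
  concurrent : ∀ l ∈ steps, ∀ r : Record V, ((fired r l).flatMap Gate.qubits).Nodup

namespace Circuit

variable {V : Type} [Fintype V]

/-- The gates applied in timestep `t` (none after the last timestep). -/
def gatesAt (C : Circuit V) (r : Record V) (t : ℕ) : List (Gate V) :=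
  fired r (C.steps.getD t [])

/-- Outcomes are recorded only where a measurement takes place. -/
def Consistent (C : Circuit V) (r : Record V) : Prop :=
  ∀ t v, r t v = true → Gate.MeasureZ v ∈ C.gatesAt r t

/-- Circuit depth: the number of timesteps. -/
def depth (C : Circuit V) : ℕ := C.steps.length

/-- Circuit size along a run: the total number of applied gates. -/
def size (C : Circuit V) (r : Record V) : ℕ :=
  ∑ t ∈ Finset.range C.depth, (C.gatesAt r t).length

/-- The qubits operated upon by any gate of the circuit. -/
def support (C : Circuit V) : Set V :=
  {v | ∃ l ∈ C.steps, ∃ i ∈ l, v ∈ i.gate.qubits}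

/-- Circuit width: the number of qubits operated upon, including those in the set `io` of input
and output qubits. -/
def width (C : Circuit V) (io : Set V) : ℕ := (C.support ∪ io).ncard

/-- The total size of the expressions that the classical controller evaluates. -/
def controllerSize (C : Circuit V) : ℕ :=
  (C.steps.map fun l => (l.map fun i => i.cond.size).sum).sum

/-- The (unnormalised) state after the first `k` timesteps, in the branch where the measurements
have the outcomes `r`. -/
def run [DecidableEq V] (C : Circuit V) (r : Record V) (ψ : State V) : ℕ → State V
  | 0 => ψ
  | k + 1 => (C.gatesAt r k).foldl (fun φ g => g.act (r k) φ) (C.run r ψ k)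

end Circuit

/-! ### Registers of qubits -/

/-- The assignment of bits to qubits in which the register `k` holds the number `val k`, low-order
bit first, and every other qubit is `0`. -/
def load {V κ : Type} {l : ℕ} (reg : κ × Fin l ↪ V) (val : κ → ℕ) : V → Bool :=
  open Classical in
    fun q => decide (∃ (k : κ) (i : Fin l), reg (k, i) = q ∧ (val k).testBit i = true)

/-- In the state `ψ` the two registers `reg` hold the numbers `w.1` and `w.2` with certainty:
every basis state of non-zero amplitude shows the bits of these numbers there. -/
def Holds {V : Type} {k l : ℕ} (reg : Fin k ⊕ Fin l ↪ V) (w : ℕ × ℕ) (ψ : State V) : Prop :=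
  ∀ x, ψ x ≠ 0 → (∀ i, x (reg (.inl i)) = w.1.testBit i) ∧ (∀ i, x (reg (.inr i)) = w.2.testBit i)

end CCNTC

end

/-!
# Constant-depth modular reduction on a planar lattice

*Arithmetic.* Truncation removes `2 ^ (n + 1)` or `2 ^ (n + 2)` for each overflow bit, and the
layers add back the residues, so the sum is preserved modulo `m` (`layer4_modEq`). Residues have
`n` bits, so from position `n` on the last three layers add two words only. The words that enter the
last layer do not both have the bit `n + 1`: one of these bits is the conjunction of `u_n` and
`v_n`, and the other can be set only if `u_n` and `v_n` differ (`layer3_testBit_and`). So no carry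
leaves the registers.

*Layout.* The qubits form twelve rows of `n + 4` columns, with edges between neighbouring rows along
the columns and along one diagonal. After a shear this is a part of the square lattice with its unit
edges. A word occupies a row, so that a bitwise operation is a timestep of gates in parallel
columns, and the diagonal edges shift a word by one position.

*Constant depth.* A circuit is compiled from commands (`Cmd`) whose number of timesteps does not
depend on `n`. A row of full adders needs one row of Toffoli gates, because the majority is
`y + (x + y) * (y + z)` over the field with two elements; the Toffoli gates are the usual
combination of `H`, `T` and CNOT gates (`exec_tofProg`). The overflow bits are moved to column
`n + 2`. To add a residue controlled on such a bit, the bit has to reach all columns at once: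
entangled pairs in the columns are joined by measurements, and the prefix parities of the outcomes
tell the controller which copies to invert (`exec_fanProg`). The copies are removed again by
measuring them in the conjugate basis, which costs a sign that a `Z` gate on the original bit
repairs (`exec_eraseProg`). On every branch of the measurements the amplitude is a power of
`1 / √2` that does not depend on the contents (`Cmd.exec_prog`).

*Clean ancillas.* The result is copied to two rows which the layers do not touch, and then the
commands are undone in reverse order (`undo_apps`): CNOT and Toffoli gates are their own inverses,
and controlled residues are erased by measurement. This leaves the inputs, the copy and zeros
(`apps_program`). The total depth is 316, each timestep applies at most `n + 3` gates, and a
condition evaluated by the controller is a parity of at most `n + 2` outcomes.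

Amplitudes are computed at the contents of the grid: all gates but `H` permute the contents or
multiply amplitudes by phases, and rows of `H` gates are handled by the explicit matrix `hadamard`.
-/

namespace CCNTC

/-! ### The grid of qubits -/

/-- The qubits: twelve rows of `n + 4` columns. A number is stored in a row, its bit of
significance `2 ^ j` in column `j`. -/
abbrev Site (n : ℕ) : Type := Fin 12 × Fin (n + 4)

/-- The qubit in row `r` and column `j` (reduced modulo the size of the grid, so that rows and
columns can be named by natural numbers). -/
def site (n r j : ℕ) : Site n := (Fin.ofNat 12 r, Fin.ofNat (n + 4) j)

theorem site_fst {n r : ℕ} (j : ℕ) (hr : r < 12) : ((site n r j).1 : ℕ) = r := by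
  simp [site, Nat.mod_eq_of_lt hr]

theorem site_snd {n j : ℕ} (r : ℕ) (hj : j < n + 4) : ((site n r j).2 : ℕ) = j := by
  simp [site, Nat.mod_eq_of_lt hj]

theorem site_eq_iff {n r j : ℕ} (hr : r < 12) (hj : j < n + 4) (v : Site n) :
    v = site n r j ↔ (v.1 : ℕ) = r ∧ (v.2 : ℕ) = j := by
  rw [Prod.ext_iff, Fin.ext_iff, Fin.ext_iff, site_fst j hr, site_snd r hj]

theorem site_inj {n r j r' j' : ℕ} (hr : r < 12) (hj : j < n + 4) (hr' : r' < 12)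
    (hj' : j' < n + 4) : site n r j = site n r' j' ↔ r = r' ∧ j = j' := by
  rw [site_eq_iff hr' hj', site_fst j hr, site_snd r hj]

/-- Row `r + 1` is joined to row `r` along the columns and along one diagonal. -/
def Below {n : ℕ} (u v : Site n) : Prop :=
  (v.1 : ℕ) = u.1 + 1 ∧ ((v.2 : ℕ) = u.2 ∨ (v.2 : ℕ) = u.2 + 1)

/-- The interaction graph: vertical and diagonal edges. -/
def gridGraph (n : ℕ) : SimpleGraph (Site n) where
  Adj u v := Below u v ∨ Below v u
  symm := ⟨fun _ _ h => h.symm⟩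
  loopless := ⟨fun v h => by rcases h with h | h <;> have := h.1 <;> omega⟩

/-- First integer coordinate of a qubit. -/
def coordX {n : ℕ} (v : Site n) : ℤ := (v.2 : ℕ)

/-- Second integer coordinate of a qubit; the shear turns the diagonal edges into horizontal
ones. -/
def coordY {n : ℕ} (v : Site n) : ℤ := ((v.1 : ℕ) : ℤ) - (v.2 : ℕ)

/-- The positions are points of the integer lattice. -/
def gridPos {n : ℕ} (v : Site n) : EuclideanSpace ℝ (Fin 2) :=
  !₂[(coordX v : ℝ), (coordY v : ℝ)]

@[simp] theorem gridPos_zero {n : ℕ} (v : Site n) : gridPos v 0 = coordX v := by simp [gridPos]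

@[simp] theorem gridPos_one {n : ℕ} (v : Site n) : gridPos v 1 = coordY v := by simp [gridPos]

theorem eq_of_coord {n : ℕ} {u v : Site n} (hx : coordX u = coordX v)
    (hy : coordY u = coordY v) : u = v := by
  simp only [coordX, coordY] at hx hy
  ext <;> omega

theorem below_coord {n : ℕ} {u v : Site n} (h : Below u v) :
    (coordX v = coordX u ∧ coordY v = coordY u + 1) ∨
      (coordX v = coordX u + 1 ∧ coordY v = coordY u) := by
  obtain ⟨h1, h2⟩ := h
  simp only [coordX, coordY]
  omega

theorem one_le_dist_gridPos {n : ℕ} {u v : Site n} (h : u ≠ v) :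
    1 ≤ dist (gridPos u) (gridPos v) := by
  rw [EuclideanSpace.dist_eq, Real.one_le_sqrt, Fin.sum_univ_two]
  simp only [gridPos_zero, gridPos_one, Real.dist_eq, sq_abs]
  have key : (1 : ℤ) ≤ (coordX u - coordX v) ^ 2 + (coordY u - coordY v) ^ 2 := by
    by_contra! hlt
    have h1 : coordX u - coordX v = 0 := by
      by_contra hne
      have := Int.one_le_abs hne
      nlinarith [sq_abs (coordX u - coordX v), sq_nonneg (coordY u - coordY v)]
    have h2 : coordY u - coordY v = 0 := by
      by_contra hne
      have := Int.one_le_abs hne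
      nlinarith [sq_abs (coordY u - coordY v), sq_nonneg (coordX u - coordX v)]
    exact h (eq_of_coord (by omega) (by omega))
  exact_mod_cast key

theorem dist_gridPos_le_of_below {n : ℕ} {u v : Site n} (h : Below u v) :
    dist (gridPos u) (gridPos v) ≤ 2 := by
  rw [EuclideanSpace.dist_eq, Real.sqrt_le_left (by norm_num), Fin.sum_univ_two]
  simp only [gridPos_zero, gridPos_one, Real.dist_eq, sq_abs]
  rcases below_coord h with ⟨hx, hy⟩ | ⟨hx, hy⟩ <;> rw [hx, hy] <;> push_cast <;> ring_nf <;>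
    norm_num

/-- A point of a closed edge lies on the unit interval that starts at the upper end. -/
theorem segment_coord {n : ℕ} {u v : Site n} (h : Below u v) {p : EuclideanSpace ℝ (Fin 2)}
    (hp : p ∈ segment ℝ (gridPos u) (gridPos v)) :
    (p 0 = coordX u ∧ (coordY u : ℝ) ≤ p 1 ∧ p 1 ≤ coordY u + 1 ∧
        coordX v = coordX u ∧ coordY v = coordY u + 1) ∨
      (p 1 = coordY u ∧ (coordX u : ℝ) ≤ p 0 ∧ p 0 ≤ coordX u + 1 ∧
        coordX v = coordX u + 1 ∧ coordY v = coordY u) := by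
  obtain ⟨s, t, hs, ht, hst, rfl⟩ := hp
  simp only [PiLp.add_apply, PiLp.smul_apply, smul_eq_mul, gridPos_zero, gridPos_one]
  rcases below_coord h with ⟨hx, hy⟩ | ⟨hx, hy⟩ <;> [left; right] <;> rw [hx, hy] <;>
    push_cast <;> obtain rfl : s = 1 - t := by linarith
  · exact ⟨by ring, by linarith, by linarith, rfl, rfl⟩
  · exact ⟨by ring, by linarith, by linarith, rfl, rfl⟩

/-- A point of an open edge is strictly between two consecutive lattice points. -/
theorem openSegment_coord {n : ℕ} {u v : Site n} (h : Below u v) {p : EuclideanSpace ℝ (Fin 2)}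
    (hp : p ∈ openSegment ℝ (gridPos u) (gridPos v)) :
    (p 0 = coordX u ∧ (coordY u : ℝ) < p 1 ∧ p 1 < coordY u + 1 ∧
        coordX v = coordX u ∧ coordY v = coordY u + 1) ∨
      (p 1 = coordY u ∧ (coordX u : ℝ) < p 0 ∧ p 0 < coordX u + 1 ∧
        coordX v = coordX u + 1 ∧ coordY v = coordY u) := by
  obtain ⟨s, t, hs, ht, hst, rfl⟩ := hp
  simp only [PiLp.add_apply, PiLp.smul_apply, smul_eq_mul, gridPos_zero, gridPos_one]
  rcases below_coord h with ⟨hx, hy⟩ | ⟨hx, hy⟩ <;> [left; right] <;> rw [hx, hy] <;>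
    push_cast <;> obtain rfl : s = 1 - t := by linarith
  · exact ⟨by ring, by linarith, by linarith, rfl, rfl⟩
  · exact ⟨by ring, by linarith, by linarith, rfl, rfl⟩

theorem vertex_off_below {n : ℕ} {u v w : Site n} (h : Below u v)
    (hw : gridPos w ∈ segment ℝ (gridPos u) (gridPos v)) : w = u ∨ w = v := by
  have := segment_coord h hw
  simp only [gridPos_zero, gridPos_one] at this
  norm_cast at this
  rcases this with ⟨h1, h2, h3, h4, h5⟩ | ⟨h1, h2, h3, h4, h5⟩
  · rcases (by omega : coordY w = coordY u ∨ coordY w = coordY u + 1) with h6 | h6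
    · exact .inl (eq_of_coord h1 h6)
    · exact .inr (eq_of_coord (by omega) (by omega))
  · rcases (by omega : coordX w = coordX u ∨ coordX w = coordX u + 1) with h6 | h6
    · exact .inl (eq_of_coord h6 h1)
    · exact .inr (eq_of_coord (by omega) (by omega))

/-- A point determines the open edge on which it lies. -/
theorem no_crossing_below {n : ℕ} {u v x y : Site n} (h : Below u v) (h' : Below x y)
    {p : EuclideanSpace ℝ (Fin 2)} (hp : p ∈ openSegment ℝ (gridPos u) (gridPos v))
    (hp' : p ∈ openSegment ℝ (gridPos x) (gridPos y)) : u = x ∧ v = y := by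
  have squeeze : ∀ {a b : ℤ} {z : ℝ}, (a : ℝ) < z → z < a + 1 → (b : ℝ) < z → z < b + 1 →
      a = b := by
    intro a b z h1 h2 h3 h4
    have h5 : (a : ℝ) < b + 1 := by linarith
    have h6 : (b : ℝ) < a + 1 := by linarith
    norm_cast at h5 h6
    omega
  have noint : ∀ {a b : ℤ} {z : ℝ}, z = a → (b : ℝ) < z → z < b + 1 → False := by
    intro a b z h1 h2 h3
    subst h1
    norm_cast at h2 h3
    omega
  rcases openSegment_coord h hp with ⟨a1, a2, a3, a4, a5⟩ | ⟨a1, a2, a3, a4, a5⟩ <;>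
    rcases openSegment_coord h' hp' with ⟨b1, b2, b3, b4, b5⟩ | ⟨b1, b2, b3, b4, b5⟩
  · have e1 : coordX u = coordX x := Int.cast_injective (a1.symm.trans b1)
    have e2 := squeeze a2 a3 b2 b3
    exact ⟨eq_of_coord e1 e2, eq_of_coord (by omega) (by omega)⟩
  · exact (noint a1 b2 b3).elim
  · exact (noint a1 b2 b3).elim
  · have e1 : coordY u = coordY x := Int.cast_injective (a1.symm.trans b1)
    have e2 := squeeze a2 a3 b2 b3
    exact ⟨eq_of_coord e2 e1, eq_of_coord (by omega) (by omega)⟩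

theorem ncard_neighborSet_le {n : ℕ} (v : Site n) : ((gridGraph n).neighborSet v).ncard ≤ 6 := by
  let F : Finset (ℤ × ℤ) := {(coordX v, coordY v + 1), (coordX v + 1, coordY v),
    (coordX v, coordY v - 1), (coordX v - 1, coordY v)}
  have hF : F.card ≤ 4 := Finset.card_le_four
  have hle : ((gridGraph n).neighborSet v).ncard ≤ (F : Set (ℤ × ℤ)).ncard := by
    refine Set.ncard_le_ncard_of_injOn (fun w => (coordX w, coordY w)) ?_ ?_ F.finite_toSet
    · intro w hw
      have : Below v w ∨ Below w v := hw
      simp only [F, Finset.coe_insert, Finset.coe_singleton, Set.mem_insert_iff,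
        Set.mem_singleton_iff, Prod.mk.injEq]
      rcases this with h | h <;> have := below_coord h <;> omega
    · intro w _ w' _ h
      simp only [Prod.mk.injEq] at h
      exact eq_of_coord h.1 h.2
  rw [Set.ncard_coe_finset] at hle
  omega

/-- The rows and columns of qubits, drawn on the square lattice. -/
def gridLayout (n : ℕ) : Layout (Site n) where
  graph := gridGraph n
  pos := gridPos
  separated _ _ h := one_le_dist_gridPos h
  edge_length u v h := by
    rcases h with h | h
    · exact dist_gridPos_le_of_below h
    · rw [dist_comm]; exact dist_gridPos_le_of_below h
  vertex_off_edge u v w h hw := by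
    rcases h with h | h
    · exact vertex_off_below h hw
    · rw [segment_symm] at hw; exact (vertex_off_below h hw).symm
  no_crossing u v x y h h' hne := by
    rw [Set.disjoint_left]
    intro p hp hp'
    apply hne
    rcases h with h | h <;> rcases h' with h' | h'
    · obtain ⟨rfl, rfl⟩ := no_crossing_below h h' hp hp'; rfl
    · rw [openSegment_symm ℝ (gridPos x)] at hp'
      obtain ⟨rfl, rfl⟩ := no_crossing_below h h' hp hp'; exact Sym2.eq_swap
    · rw [openSegment_symm ℝ (gridPos u)] at hp
      obtain ⟨rfl, rfl⟩ := no_crossing_below h h' hp hp'; exact Sym2.eq_swap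
    · rw [openSegment_symm ℝ (gridPos u)] at hp
      rw [openSegment_symm ℝ (gridPos x)] at hp'
      obtain ⟨rfl, rfl⟩ := no_crossing_below h h' hp hp'; rfl
  degree_le := ncard_neighborSet_le

/-! ### Classical contents of the grid -/

/-- A classical content of the grid: the bit in each row and column. -/
abbrev Grid : Type := ℕ → ℕ → Bool

/-- The restriction of a content to the qubits of the grid. -/
def display (n : ℕ) (w : Grid) : Site n → Bool := fun v => w v.1 v.2

theorem display_site {n r j : ℕ} (w : Grid) (hr : r < 12) (hj : j < n + 4) :
    display n w (site n r j) = w r j := by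
  rw [display, site_fst j hr, site_snd r hj]

theorem display_congr {n : ℕ} {w w' : Grid} (h : ∀ r < 12, ∀ j < n + 4, w r j = w' r j) :
    display n w = display n w' :=
  funext fun v => h v.1 v.1.2 v.2 v.2.2

theorem display_eq_iff {n : ℕ} {w w' : Grid} :
    display n w = display n w' ↔ ∀ r < 12, ∀ j < n + 4, w r j = w' r j := by
  refine ⟨fun h r hr j hj => ?_, display_congr⟩
  rw [← display_site w hr hj, h, display_site w' hr hj]

theorem display_surjective (n : ℕ) : Function.Surjective (display n) := by
  intro x
  refine ⟨fun r j => x (site n r j), funext fun v => ?_⟩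
  rw [display]
  exact congrArg x (((site_eq_iff v.1.2 v.2.2 v).2 ⟨rfl, rfl⟩).symm)

theorem state_ext {n : ℕ} {ψ φ : State (Site n)}
    (h : ∀ w, ψ (display n w) = φ (display n w)) : ψ = φ := by
  funext x
  obtain ⟨w, rfl⟩ := display_surjective n x
  exact h w

theorem ket_display {n : ℕ} (y w : Grid) : ket (display n y) (display n w) =
    open Classical in if ∀ r < 12, ∀ j < n + 4, w r j = y r j then 1 else 0 := by
  rw [ket]
  by_cases h : display n w = display n y
  · rw [if_pos h, if_pos (display_eq_iff.1 h)]
  · rw [if_neg h, if_neg (mt display_eq_iff.2 h)]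

theorem update_display {n r j : ℕ} (w : Grid) (b : Bool) (hr : r < 12) (hj : j < n + 4) :
    Function.update (display n w) (site n r j) b =
      display n (fun i k => if i = r ∧ k = j then b else w i k) := by
  funext v
  rw [Function.update_apply, display]
  simp only [site_eq_iff hr hj]
  rfl

/-! ### Running lists of timesteps -/

/-- The state after the timesteps `prog`, the first of which has the number `t`. -/
noncomputable def exec {V : Type} [DecidableEq V] (r : Record V) :
    ℕ → List (List (Instr V)) → State V → State V
  | _, [], ψ => ψ
  | t, l :: prog, ψ => exec r (t + 1) prog ((fired r l).foldl (fun φ g => g.act (r t) φ) ψ)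

theorem exec_append {V : Type} [DecidableEq V] (r : Record V) (A B : List (List (Instr V))) :
    ∀ (t : ℕ) (ψ : State V), exec r t (A ++ B) ψ = exec r (t + A.length) B (exec r t A ψ) := by
  induction A with
  | nil => intro t ψ; rfl
  | cons l A ih =>
    intro t ψ
    rw [List.cons_append, exec, ih, exec, List.length_cons, Nat.add_right_comm, Nat.add_assoc]

theorem act_smul {V : Type} [DecidableEq V] (o : V → Bool) (g : Gate V) (α : ℂ) (ψ : State V) :
    g.act o (α • ψ) = α • g.act o ψ := by
  funext x
  cases g <;> simp only [Gate.act, Pi.smul_apply, smul_eq_mul] <;> first | ring1 | rfl | skip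
  split_ifs <;> simp

theorem foldl_act_smul {V : Type} [DecidableEq V] (o : V → Bool) (l : List (Gate V)) (α : ℂ) :
    ∀ ψ : State V, l.foldl (fun φ g => g.act o φ) (α • ψ) =
      α • l.foldl (fun φ g => g.act o φ) ψ := by
  induction l with
  | nil => intro ψ; rfl
  | cons g l ih => intro ψ; rw [List.foldl_cons, act_smul, ih, List.foldl_cons]

theorem exec_smul {V : Type} [DecidableEq V] (r : Record V) (α : ℂ)
    (A : List (List (Instr V))) : ∀ (t : ℕ) (ψ : State V),
    exec r t A (α • ψ) = α • exec r t A ψ := by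
  induction A with
  | nil => intro t ψ; rfl
  | cons l A ih => intro t ψ; rw [exec, foldl_act_smul, ih, exec]

theorem run_eq_exec {V : Type} [Fintype V] [DecidableEq V] (C : Circuit V) (r : Record V)
    (ψ : State V) (A B : List (List (Instr V))) (h : C.steps = A ++ B) :
    C.run r ψ A.length = exec r 0 A ψ := by
  induction A using List.reverseRecOn generalizing B with
  | nil => rfl
  | append_singleton A l ih =>
    rw [List.append_assoc] at h
    rw [List.length_append, List.length_singleton, Circuit.run, ih _ h, exec_append, exec, exec,
      Nat.zero_add, Circuit.gatesAt, h]
    simp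

/-! ### The action of rows of gates -/

/-- The columns selected by the mask `S`; the last column is never selected, so that the
diagonal neighbour of a selected qubit exists. -/
def cols (n : ℕ) (S : ℕ → Bool) : List ℕ := (List.range (n + 3)).filter S

theorem mem_cols {n j : ℕ} {S : ℕ → Bool} : j ∈ cols n S ↔ j < n + 3 ∧ S j = true := by
  simp [cols]

theorem nodup_cols (n : ℕ) (S : ℕ → Bool) : (cols n S).Nodup := List.nodup_range.filter _

/-- A timestep that applies one gate for each selected column. -/
def rowStep (n : ℕ) (S : ℕ → Bool) (c : ℕ → Cond (Site n)) (g : ℕ → Gate (Site n)) :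
    List (Instr (Site n)) := (cols n S).map fun j => ⟨c j, g j⟩

/-- The unconditional condition. -/
abbrev always {n : ℕ} : ℕ → Cond (Site n) := fun _ => .const true

theorem fired_rowStep {n : ℕ} (S : ℕ → Bool) (c : ℕ → Cond (Site n)) (g : ℕ → Gate (Site n))
    (r : Record (Site n)) :
    fired r (rowStep n S c g) = (cols n (fun j => S j && (c j).eval r)).map g := by
  simp only [fired, rowStep, cols, List.filter_map, List.filter_filter, List.map_map]
  congr 1
  apply List.filter_congr
  intro j _
  simp [Bool.and_comm]

/-- The state after a row of gates. -/
noncomputable def rowAct (n : ℕ) (o : Site n → Bool) (S : ℕ → Bool) (g : ℕ → Gate (Site n))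
    (ψ : State (Site n)) : State (Site n) :=
  ((cols n S).map g).foldl (fun φ g => g.act o φ) ψ

theorem exec_rowStep {n : ℕ} (r : Record (Site n)) (t : ℕ) (S : ℕ → Bool)
    (c : ℕ → Cond (Site n)) (g : ℕ → Gate (Site n)) (prog : List (List (Instr (Site n))))
    (ψ : State (Site n)) :
    exec r t (rowStep n S c g :: prog) ψ =
      exec r (t + 1) prog (rowAct n (r t) (fun j => S j && (c j).eval r) g ψ) := by
  rw [exec, fired_rowStep, rowAct]

theorem exec_nil {V : Type} [DecidableEq V] (r : Record V) (t : ℕ) (ψ : State V) :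
    exec r t [] ψ = ψ := rfl

/-- A row of gates each of which permutes the basis states. -/
theorem foldl_act_perm {n : ℕ} (o : Site n → Bool) (g : ℕ → Gate (Site n)) (F : ℕ → Grid → Grid)
    (L : List ℕ) (hg : ∀ j ∈ L, ∀ ψ w, (g j).act o ψ (display n w) = ψ (display n (F j w))) :
    ∀ ψ w, (L.map g).foldl (fun φ g => g.act o φ) ψ (display n w) =
      ψ (display n (L.foldr F w)) := by
  induction L with
  | nil => intro ψ w; rfl
  | cons j L ih =>
    intro ψ w
    rw [List.map_cons, List.foldl_cons, ih (fun i hi => hg i (List.mem_cons_of_mem _ hi)),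
      hg j List.mem_cons_self, List.foldr_cons]

/-- The effect on the contents of a row of CNOT gates: each selected bit `j + d` of row `p` is
added to the bit `j + e` of row `q`. -/
def cnotApp (p q d e : ℕ) (S : ℕ → Bool) (w : Grid) : Grid := fun i k =>
  if i = q ∧ e ≤ k ∧ S (k - e) = true then xor (w i k) (w p (k - e + d)) else w i k

theorem rowAct_cnot {n p q d e : ℕ} (o : Site n → Bool) {S : ℕ → Bool}
    (hS : ∀ j, S j = true → j < n + 3) (hp : p < 12) (hq : q < 12) (hpq : p ≠ q) (hd : d ≤ 1)
    (he : e ≤ 1) (ψ : State (Site n)) (w : Grid) :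
    rowAct n o S (fun j => .CNOT (site n p (j + d)) (site n q (j + e))) ψ (display n w) =
      ψ (display n (cnotApp p q d e S w)) := by
  rw [rowAct, foldl_act_perm o _
    (fun j w i k => if i = q ∧ k = j + e then xor (w i k) (w p (j + d)) else w i k)]
  · congr 2
    suffices H : ∀ L : List ℕ, L.Nodup → L.foldr
        (fun j (w : Grid) i k =>
          if i = q ∧ k = j + e then xor (w i k) (w p (j + d)) else w i k) w =
        fun i k => if i = q ∧ e ≤ k ∧ k - e ∈ L then xor (w i k) (w p (k - e + d)) else w i k by
      rw [H _ (nodup_cols n S)]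
      funext i k
      have : k - e ∈ cols n S ↔ S (k - e) = true :=
        ⟨fun h => (mem_cols.1 h).2, fun h => mem_cols.2 ⟨hS _ h, h⟩⟩
      simp only [cnotApp, this]
    intro L
    induction L with
    | nil => intro _; funext i k; simp
    | cons j L ih =>
      intro hL
      rw [List.nodup_cons] at hL
      rw [List.foldr_cons, ih hL.2]
      funext i k
      by_cases hi : i = q
      · subst hi
        by_cases hk : k = j + e
        · subst hk
          simp [hpq, hL.1]
        · by_cases hek : e ≤ k
          · have : ¬ k - e = j := by omega
            simp [hk, this]
          · simp [hk, hek]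
      · simp [hi]
  · intro j hj ψ w
    have := (mem_cols.1 hj).1
    simp only [Gate.act]
    rw [display_site w hq (by omega), display_site w hp (by omega),
      update_display w _ hq (by omega)]
    congr 2
    funext i k
    split_ifs with h
    · rw [h.1, h.2]
    · rfl

/-- The effect on the contents of a row of X gates. -/
def flipApp (p : ℕ) (S : ℕ → Bool) (w : Grid) : Grid := fun i k =>
  if i = p ∧ S k = true then !w i k else w i k

theorem rowAct_X {n p : ℕ} (o : Site n → Bool) {S : ℕ → Bool}
    (hS : ∀ j, S j = true → j < n + 3) (hp : p < 12) (ψ : State (Site n)) (w : Grid) :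
    rowAct n o S (fun j => .X (site n p j)) ψ (display n w) = ψ (display n (flipApp p S w)) := by
  rw [rowAct, foldl_act_perm o _
    (fun j w i k => if i = p ∧ k = j then !w i k else w i k)]
  · congr 2
    suffices H : ∀ L : List ℕ, L.Nodup → L.foldr
        (fun j (w : Grid) i k => if i = p ∧ k = j then !w i k else w i k) w =
        fun i k => if i = p ∧ k ∈ L then !w i k else w i k by
      rw [H _ (nodup_cols n S)]
      funext i k
      have : k ∈ cols n S ↔ S k = true :=
        ⟨fun h => (mem_cols.1 h).2, fun h => mem_cols.2 ⟨hS _ h, h⟩⟩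
      simp only [flipApp, this]
    intro L
    induction L with
    | nil => intro _; funext i k; simp
    | cons j L ih =>
      intro hL
      rw [List.nodup_cons] at hL
      rw [List.foldr_cons, ih hL.2]
      funext i k
      by_cases hi : i = p
      · by_cases hk : k = j
        · subst hk
          simp [hL.1, hi]
        · simp [hk]
      · simp [hi]
  · intro j hj ψ w
    have := (mem_cols.1 hj).1
    simp only [Gate.act]
    rw [display_site w hp (by omega), update_display w _ hp (by omega)]
    congr 2
    funext i k
    split_ifs with h
    · rw [h.1, h.2]
    · rfl

/-- A row of gates each of which multiplies the amplitudes by a factor. -/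
theorem rowAct_mul {n : ℕ} (o : Site n → Bool) (S : ℕ → Bool) (g : ℕ → Gate (Site n))
    (f : ℕ → ℂ) (w : Grid)
    (hg : ∀ j < n + 3, ∀ ψ, (g j).act o ψ (display n w) = f j * ψ (display n w))
    (ψ : State (Site n)) :
    rowAct n o S g ψ (display n w) = ((cols n S).map f).prod * ψ (display n w) := by
  rw [rowAct]
  have : ∀ j ∈ cols n S, j < n + 3 := fun j hj => (mem_cols.1 hj).1
  revert this
  generalize cols n S = L
  induction L generalizing ψ with
  | nil => intro _; simp
  | cons j L ih =>
    intro hL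
    rw [List.map_cons, List.foldl_cons, ih _ fun i hi => hL i (List.mem_cons_of_mem _ hi),
      hg j (hL j List.mem_cons_self), List.map_cons, List.prod_cons]
    ring

theorem rowAct_Z {n p : ℕ} (o : Site n → Bool) (S : ℕ → Bool) (hp : p < 12)
    (ψ : State (Site n)) (w : Grid) :
    rowAct n o S (fun j => .Z (site n p j)) ψ (display n w) =
      ((cols n S).map fun j => if w p j then -1 else (1 : ℂ)).prod * ψ (display n w) := by
  refine rowAct_mul o S _ _ w (fun j hj ψ => ?_) ψ
  simp only [Gate.act, display_site w hp (show j < n + 4 by omega)]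

/-- The phase of the gate `T`. -/
noncomputable def tPhase : ℂ := Complex.exp (Complex.I * (Real.pi / 4))

/-- The phase of the gate `T†`. -/
noncomputable def tdgPhase : ℂ := Complex.exp (-(Complex.I * (Real.pi / 4)))

theorem tPhase_mul_tdgPhase : tPhase * tdgPhase = 1 := by
  rw [tPhase, tdgPhase, ← Complex.exp_add, add_neg_cancel, Complex.exp_zero]

theorem tPhase_pow_four : tPhase ^ 4 = -1 := by
  rw [tPhase, ← Complex.exp_nat_mul, ← Complex.exp_pi_mul_I]
  congr 1
  push_cast
  ring

theorem rowAct_T {n p : ℕ} (o : Site n → Bool) (S : ℕ → Bool) (hp : p < 12)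
    (ψ : State (Site n)) (w : Grid) :
    rowAct n o S (fun j => .T (site n p j)) ψ (display n w) =
      ((cols n S).map fun j => if w p j then tPhase else 1).prod * ψ (display n w) := by
  refine rowAct_mul o S _ _ w (fun j hj ψ => ?_) ψ
  simp only [Gate.act, display_site w hp (show j < n + 4 by omega), tPhase]

theorem rowAct_Tdg {n p : ℕ} (o : Site n → Bool) (S : ℕ → Bool) (hp : p < 12)
    (ψ : State (Site n)) (w : Grid) :
    rowAct n o S (fun j => .Tdg (site n p j)) ψ (display n w) =
      ((cols n S).map fun j => if w p j then tdgPhase else 1).prod * ψ (display n w) := by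
  refine rowAct_mul o S _ _ w (fun j hj ψ => ?_) ψ
  simp only [Gate.act, display_site w hp (show j < n + 4 by omega), tdgPhase]

theorem rowAct_measure {n p : ℕ} (o : Site n → Bool) (S : ℕ → Bool) (hp : p < 12)
    (ψ : State (Site n)) (w : Grid) :
    rowAct n o S (fun j => .MeasureZ (site n p j)) ψ (display n w) =
      open Classical in
      if ∀ j ∈ cols n S, w p j = o (site n p j) then ψ (display n w) else 0 := by
  classical
  rw [rowAct_mul o S _ (fun j => if w p j = o (site n p j) then 1 else 0) w]
  · generalize cols n S = L
    induction L with
    | nil => simp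
    | cons j L ih =>
      rw [List.map_cons, List.prod_cons, mul_assoc, ih]
      by_cases h : w p j = o (site n p j) <;> simp [h]
  · intro j hj ψ
    simp only [Gate.act, display_site w hp (show j < n + 4 by omega)]
    split_ifs <;> simp

/-- The amplitude `1 / √2` of the Hadamard gate. -/
noncomputable def hAmp : ℂ := ((Real.sqrt 2 : ℝ) : ℂ)⁻¹

theorem two_mul_hAmp_sq : 2 * hAmp ^ 2 = 1 := by
  have : ((Real.sqrt 2 : ℝ) : ℂ) ^ 2 = 2 := by
    rw [← Complex.ofReal_pow, Real.sq_sqrt (by norm_num)]; norm_num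
  rw [hAmp, inv_pow, this]
  norm_num

theorem act_H_H {V : Type} [DecidableEq V] (o : V → Bool) (v : V) (ψ : State V) :
    (Gate.H v).act o ((Gate.H v).act o ψ) = ψ := by
  funext x
  have h := two_mul_hAmp_sq
  rw [hAmp] at h
  cases hx : x v
  · have : Function.update x v false = x := by rw [← hx, Function.update_eq_self]
    simp [Gate.act, hx, this]
    linear_combination (ψ x) * h
  · have : Function.update x v true = x := by rw [← hx, Function.update_eq_self]
    simp [Gate.act, hx, this]
    linear_combination (ψ x) * h

theorem foldl_H_reverse {V : Type} [DecidableEq V] (o : V → Bool) (L : List V) :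
    ∀ ψ : State V, (L.map Gate.H).foldl (fun φ g => g.act o φ)
      ((L.reverse.map Gate.H).foldl (fun φ g => g.act o φ) ψ) = ψ := by
  induction L with
  | nil => intro ψ; rfl
  | cons v L ih =>
    intro ψ
    rw [List.reverse_cons, List.map_append, List.foldl_append, List.map_cons, List.foldl_cons]
    simp only [List.map_cons, List.map_nil, List.foldl_cons, List.foldl_nil]
    rw [act_H_H, ih]

/-- The amplitudes of the uniform superposition that Hadamard gates on the qubits of row `p` in
the columns `L` make of the basis state `y`. -/
noncomputable def hadamard (n p : ℕ) (L : List ℕ) (y w : Grid) : ℂ :=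
  open Classical in
  if ∀ i < 12, ∀ k < n + 4, (i = p ∧ k ∈ L) ∨ w i k = y i k then
    hAmp ^ L.length * (L.map fun j => if w p j && y p j then -1 else (1 : ℂ)).prod
  else 0

theorem foldl_H {n p : ℕ} (o : Site n → Bool) (hp : p < 12) (y : Grid) (L : List ℕ)
    (hL : ∀ j ∈ L, j < n + 3) (hnd : L.Nodup) (w : Grid) :
    (L.map fun j => Gate.H (site n p j)).foldl (fun φ g => g.act o φ) (ket (display n y))
      (display n w) = hadamard n p L y w := by
  classical
  induction L using List.reverseRecOn generalizing w with
  | nil => simp [hadamard, ket_display]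
  | append_singleton L j ih =>
    have hj : j < n + 4 := by have := hL j (by simp); omega
    rw [List.nodup_append] at hnd
    have hjL : j ∉ L := fun h => hnd.2.2 j h j (by simp) rfl
    rw [List.map_append, List.foldl_append]
    simp only [List.map_cons, List.map_nil, List.foldl_cons, List.foldl_nil]
    rw [Gate.act]
    beta_reduce
    rw [update_display _ _ hp hj, update_display _ _ hp hj, display_site _ hp hj,
      ih (fun i hi => hL i (by simp [hi])) hnd.1, ih (fun i hi => hL i (by simp [hi])) hnd.1]
    have hprod : ∀ b : Bool, (L.map fun j' =>
        if (if p = p ∧ j' = j then b else w p j') && y p j' then -1 else (1 : ℂ)).prod =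
        (L.map fun j => if w p j && y p j then -1 else (1 : ℂ)).prod := by
      intro b
      congr 1
      apply List.map_congr_left
      intro i hi
      have : i ≠ j := fun h => hjL (h ▸ hi)
      simp [this]
    have hcond : ∀ b : Bool, (∀ i < 12, ∀ k < n + 4, (i = p ∧ k ∈ L) ∨
        (if i = p ∧ k = j then b else w i k) = y i k) ↔ (b = y p j ∧
        ∀ i < 12, ∀ k < n + 4, (i = p ∧ k ∈ L ++ [j]) ∨ w i k = y i k) := by
      intro b
      constructor
      · intro h
        refine ⟨by simpa [hjL] using h p hp j hj, fun i hi k hk => ?_⟩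
        by_cases hik : i = p ∧ k = j
        · exact .inl ⟨hik.1, by simp [hik.2]⟩
        · rcases h i hi k hk with h | h
          · exact .inl ⟨h.1, by simp [h.2]⟩
          · rw [if_neg hik] at h; exact .inr h
      · rintro ⟨hb, h⟩ i hi k hk
        by_cases hik : i = p ∧ k = j
        · right; rw [if_pos hik, hik.1, hik.2, hb]
        · rcases h i hi k hk with h | h
          · left
            refine ⟨h.1, ?_⟩
            rcases List.mem_append.1 h.2 with h' | h'
            · exact h'
            · exact absurd ⟨h.1, by simpa using h'⟩ hik
          · right; rw [if_neg hik, h]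
    by_cases H : ∀ i < 12, ∀ k < n + 4, (i = p ∧ k ∈ L ++ [j]) ∨ w i k = y i k
    · have key : ∀ b : Bool, hadamard n p L y (fun i k => if i = p ∧ k = j then b else w i k) =
          if b = y p j then
            hAmp ^ L.length * (L.map fun j => if w p j && y p j then -1 else (1 : ℂ)).prod
          else 0 := by
        intro b
        rw [hadamard]
        by_cases h : b = y p j
        · rw [if_pos h, if_pos ((hcond b).2 ⟨h, H⟩), hprod]
        · rw [if_neg h, if_neg fun h' => h ((hcond b).1 h').1]
      rw [key, key, hadamard, if_pos H, ← hAmp]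
      simp only [List.length_append, List.length_singleton,
        List.map_append, List.prod_append, List.map_cons, List.map_nil, List.prod_singleton]
      cases y p j <;> cases w p j <;> simp [pow_succ] <;> ring
    · have key : ∀ b : Bool, hadamard n p L y (fun i k => if i = p ∧ k = j then b else w i k) =
          0 := fun b => by rw [hadamard, if_neg fun h' => H ((hcond b).1 h').2]
      rw [key, key, hadamard, if_neg H]
      simp

theorem rowAct_H {n p : ℕ} (o : Site n → Bool) (S : ℕ → Bool) (hp : p < 12) (y w : Grid) :
    rowAct n o S (fun j => .H (site n p j)) (ket (display n y)) (display n w) =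
      hadamard n p (cols n S) y w :=
  foldl_H o hp y _ (fun _ h => (mem_cols.1 h).1) (nodup_cols n S) w

/-- Two rows of Hadamard gates cancel. -/
theorem rowAct_H_of_eq_hadamard {n p : ℕ} (o : Site n → Bool) (S : ℕ → Bool) (hp : p < 12)
    (y : Grid) (ψ : State (Site n)) (hψ : ∀ w, ψ (display n w) = hadamard n p (cols n S) y w) :
    rowAct n o S (fun j => .H (site n p j)) ψ = ket (display n y) := by
  have : ψ = ((cols n S).reverse.map fun j => Gate.H (site n p j)).foldl
      (fun φ g => g.act o φ) (ket (display n y)) := by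
    refine state_ext fun w => ?_
    rw [hψ, foldl_H o hp y _ (fun _ h => (mem_cols.1 (List.mem_reverse.1 h)).1)
      (List.nodup_reverse.2 (nodup_cols n S))]
    simp only [hadamard, List.length_reverse, List.map_reverse, List.prod_reverse]
    by_cases h : ∀ i < 12, ∀ k < n + 4, (i = p ∧ k ∈ cols n S) ∨ w i k = y i k
    · rw [if_pos h, if_pos (by simpa only [List.mem_reverse] using h)]
    · rw [if_neg h, if_neg (by simpa only [List.mem_reverse] using h)]
  rw [this, rowAct]
  have := foldl_H_reverse o ((cols n S).map (site n p)) (ket (display n y))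
  rwa [← List.map_reverse, List.map_map, List.map_map] at this

/-! ### Rows of classical gates on basis states -/

theorem ket_involution {n : ℕ} {f : Grid → Grid} (hf : ∀ w, f (f w) = w)
    (hd : ∀ w w', display n w = display n w' → display n (f w) = display n (f w')) (y w : Grid) :
    ket (display n y) (display n (f w)) = ket (display n (f y)) (display n w) := by
  have : display n (f w) = display n y ↔ display n w = display n (f y) :=
    ⟨fun h => by have := hd _ _ h; rwa [hf] at this,
      fun h => by have := hd _ _ h; rwa [hf] at this⟩
  rw [ket, ket]
  by_cases h : display n (f w) = display n y
  · rw [if_pos h, if_pos (this.1 h)]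
  · rw [if_neg h, if_neg (mt this.2 h)]

theorem cnotApp_cnotApp {p q : ℕ} (hpq : p ≠ q) (d e : ℕ) (S : ℕ → Bool) (w : Grid) :
    cnotApp p q d e S (cnotApp p q d e S w) = w := by
  funext i k
  simp only [cnotApp]
  by_cases h : i = q ∧ e ≤ k ∧ S (k - e) = true
  · simp [h, hpq]
  · simp [h]

theorem rowAct_cnot_ket {n p q d e : ℕ} (o : Site n → Bool) {S : ℕ → Bool}
    (hS : ∀ j, S j = true → j < n + 3) (hp : p < 12) (hq : q < 12) (hpq : p ≠ q) (hd : d ≤ 1)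
    (he : e ≤ 1) (y : Grid) :
    rowAct n o S (fun j => .CNOT (site n p (j + d)) (site n q (j + e))) (ket (display n y)) =
      ket (display n (cnotApp p q d e S y)) := by
  refine state_ext fun w => ?_
  rw [rowAct_cnot o hS hp hq hpq hd he]
  refine ket_involution (cnotApp_cnotApp hpq d e S) (fun w w' h => ?_) y w
  rw [display_eq_iff] at h ⊢
  intro r hr j hj
  simp only [cnotApp]
  split_ifs with h1
  · rw [h r hr j hj, h p hp _ (by have := hS _ h1.2.2; omega)]
  · exact h r hr j hj

theorem rowAct_X_ket {n p : ℕ} (o : Site n → Bool) {S : ℕ → Bool}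
    (hS : ∀ j, S j = true → j < n + 3) (hp : p < 12) (y : Grid) :
    rowAct n o S (fun j => .X (site n p j)) (ket (display n y)) =
      ket (display n (flipApp p S y)) := by
  refine state_ext fun w => ?_
  rw [rowAct_X o hS hp]
  refine ket_involution (fun w => ?_) (fun w w' h => ?_) y w
  · funext i k
    simp only [flipApp]
    split_ifs <;> simp
  · rw [display_eq_iff] at h ⊢
    intro r hr j hj
    simp only [flipApp, h r hr j hj]

/-! ### The Toffoli gate -/

/-- A timestep of CNOT gates with controls `(p, j + d)` and targets `(q, j + e)`. -/
def cnotStep (n p q d e : ℕ) (S : ℕ → Bool) : List (Instr (Site n)) :=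
  rowStep n S always fun j => .CNOT (site n p (j + d)) (site n q (j + e))

/-- Hadamard gates on row `p`. -/
def hStep (n p : ℕ) (S : ℕ → Bool) : List (Instr (Site n)) :=
  rowStep n S always fun j => .H (site n p j)

/-- Gates `T` on row `p`. -/
def tStep (n p : ℕ) (S : ℕ → Bool) : List (Instr (Site n)) :=
  rowStep n S always fun j => .T (site n p j)

/-- Gates `T†` on row `p`. -/
def tdgStep (n p : ℕ) (S : ℕ → Bool) : List (Instr (Site n)) :=
  rowStep n S always fun j => .Tdg (site n p j)

/-- Measurements of row `p`. -/
def measureStep (n p : ℕ) (S : ℕ → Bool) : List (Instr (Site n)) :=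
  rowStep n S always fun j => .MeasureZ (site n p j)

/-- The doubly controlled sign on the rows `p`, `p + 1`, `p + 2`: the CNOT gates produce the
seven parities of the three bits on neighbouring qubits, and each receives its phase. -/
def cczProg (n p : ℕ) (S : ℕ → Bool) : List (List (Instr (Site n))) :=
  [tStep n p S, tStep n (p + 1) S, tStep n (p + 2) S,
    cnotStep n (p + 1) (p + 2) 0 0 S, tdgStep n (p + 2) S,
    cnotStep n p (p + 1) 0 0 S, tdgStep n (p + 1) S,
    cnotStep n (p + 1) (p + 2) 0 0 S, tdgStep n (p + 2) S,
    cnotStep n p (p + 1) 0 0 S,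
    cnotStep n (p + 1) (p + 2) 0 0 S, tStep n (p + 2) S,
    cnotStep n p (p + 1) 0 0 S, cnotStep n (p + 1) (p + 2) 0 0 S, cnotStep n p (p + 1) 0 0 S]

/-- Toffoli gates with controls in the rows `p` and `p + 1` and targets in the row `p + 2`. -/
def tofProg (n p : ℕ) (S : ℕ → Bool) : List (List (Instr (Site n))) :=
  hStep n (p + 2) S :: (cczProg n p S ++ [hStep n (p + 2) S])

/-- The effect of the Toffoli gates on the contents. -/
def tofApp (p : ℕ) (S : ℕ → Bool) (w : Grid) : Grid := fun i k =>
  if i = p + 2 ∧ S k = true then xor (w i k) (w p k && w (p + 1) k) else w i k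

theorem exec_cczProg {n p : ℕ} (r : Record (Site n)) (t : ℕ) {S : ℕ → Bool}
    (hS : ∀ j, S j = true → j < n + 3) (hp : p + 2 < 12) (ψ : State (Site n)) (w : Grid) :
    exec r t (cczProg n p S) ψ (display n w) =
      ((cols n S).map fun j => if w p j && w (p + 1) j && w (p + 2) j then -1 else (1 : ℂ)).prod *
        ψ (display n w) := by
  have h01 := fun (o : Site n → Bool) ψ w => rowAct_cnot (d := 0) (e := 0) (q := p + 1) o hS
    (by omega : p < 12) (by omega) (by omega) (by omega) (by omega) ψ w
  have h12 := fun (o : Site n → Bool) ψ w => rowAct_cnot (d := 0) (e := 0) (q := p + 2) o hS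
    (by omega : p + 1 < 12) (by omega) (by omega) (by omega) (by omega) ψ w
  have hT := fun q (hq : q < 12) (o : Site n → Bool) ψ w => rowAct_T o S hq ψ w
  have hTd := fun q (hq : q < 12) (o : Site n → Bool) ψ w => rowAct_Tdg o S hq ψ w
  simp only [cczProg, cnotStep, tStep, tdgStep, exec_rowStep, Cond.eval, Bool.and_true, exec_nil]
  simp only [h01, h12, hT p (by omega), hT (p + 1) (by omega), hT (p + 2) (by omega),
    hTd (p + 1) (by omega), hTd (p + 2) (by omega)]
  simp only [← mul_assoc, ← List.prod_map_mul]
  congr 1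
  · congr 1
    apply List.map_congr_left
    intro j hj
    have hSj := (mem_cols.1 hj).2
    have h1 := tPhase_mul_tdgPhase
    have h4 := tPhase_pow_four
    simp only [cnotApp, Nat.sub_zero, Nat.add_zero, Nat.zero_le, hSj, and_true,
      Nat.left_eq_add, Nat.add_right_inj, Nat.reduceEqDiff, if_true, if_false,
      one_ne_zero, OfNat.ofNat_ne_zero]
    -- The phases `T` outnumber the phases `T†` by four if all three bits are set, and balance
    -- them otherwise.
    cases w p j <;> cases w (p + 1) j <;> cases w (p + 2) j <;> simp <;>
      first
      | linear_combination (tPhase * tdgPhase + 1) * h1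
      | linear_combination h4
  · congr 2
    funext i k
    simp only [cnotApp]
    by_cases hk : S k = true
    · by_cases h1 : i = p + 1
      · subst h1; simp [hk]
      · by_cases h2 : i = p + 2
        · subst h2; simp [hk]
        · simp [h1, h2]
    · simp [hk]

theorem mul_hadamard_tofApp {n p : ℕ} (S : ℕ → Bool) (hS : ∀ j, S j = true → j < n + 3)
    (hp : p + 2 < 12) (y w : Grid) :
    ((cols n S).map fun j => if w p j && w (p + 1) j && w (p + 2) j then -1 else (1 : ℂ)).prod *
      hadamard n (p + 2) (cols n S) y w = hadamard n (p + 2) (cols n S) (tofApp p S y) w := by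
  have hcond : (∀ i < 12, ∀ k < n + 4, (i = p + 2 ∧ k ∈ cols n S) ∨ w i k = tofApp p S y i k) ↔
      ∀ i < 12, ∀ k < n + 4, (i = p + 2 ∧ k ∈ cols n S) ∨ w i k = y i k := by
    refine forall₄_congr fun i hi k hk => ?_
    by_cases h : i = p + 2 ∧ S k = true
    · simp [h.1, mem_cols.2 ⟨hS k h.2, h.2⟩]
    · rw [tofApp, if_neg h]
  rw [hadamard, hadamard]
  by_cases H : ∀ i < 12, ∀ k < n + 4, (i = p + 2 ∧ k ∈ cols n S) ∨ w i k = y i k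
  · rw [if_pos H, if_pos (hcond.2 H), mul_left_comm, ← List.prod_map_mul]
    congr 2
    apply List.map_congr_left
    intro j hj
    obtain ⟨hj1, hj2⟩ := mem_cols.1 hj
    have h0 : w p j = y p j := (H p (by omega) j (by omega)).resolve_left (by simp)
    have h1 : w (p + 1) j = y (p + 1) j :=
      (H (p + 1) (by omega) j (by omega)).resolve_left (by simp)
    simp only [tofApp, hj2, and_self, if_true, h0, h1]
    cases y p j <;> cases y (p + 1) j <;> cases y (p + 2) j <;> cases w (p + 2) j <;> simp
  · rw [if_neg H, if_neg (mt hcond.1 H), mul_zero]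

/-- On basis states, `H` turns the doubly controlled sign into a controlled-controlled NOT. -/
theorem exec_tofProg {n p : ℕ} (r : Record (Site n)) (t : ℕ) {S : ℕ → Bool}
    (hS : ∀ j, S j = true → j < n + 3) (hp : p + 2 < 12) (y : Grid) :
    exec r t (tofProg n p S) (ket (display n y)) = ket (display n (tofApp p S y)) := by
  simp only [tofProg, hStep, exec_rowStep, exec_append, Cond.eval, Bool.and_true, exec_nil]
  refine rowAct_H_of_eq_hadamard _ S hp _ _ fun w => ?_
  rw [exec_cczProg r _ hS hp, rowAct_H _ S hp, mul_hadamard_tofApp S hS hp]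

/-! ### Measured Hadamard rows -/

/-- The parity of a list of conditions. -/
def parityCond {V : Type} (l : List (Cond V)) : Cond V := l.foldr .parity (.const false)

/-- The mask of the columns `0, …, n + 1`. -/
def full (n : ℕ) : ℕ → Bool := fun j => decide (j < n + 2)

theorem full_lt {n : ℕ} : ∀ j, full n j = true → j < n + 3 := by
  intro j hj
  have : j < n + 2 := by simpa [full] using hj
  omega

/-- Measuring a row after Hadamard gates replaces its bits by the outcomes `o`, with signs for
the bits that both were set and have outcome one. -/
theorem measured_hadamard {n p : ℕ} {S : ℕ → Bool} (hS : ∀ j, S j = true → j < n + 3)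
    (hp : p < 12) (o : ℕ → Bool) (y w : Grid) :
    (open Classical in
      if ∀ j ∈ cols n S, w p j = o j then hadamard n p (cols n S) y w else 0) =
    hAmp ^ (cols n S).length *
        ((cols n S).map fun j => if o j && y p j then -1 else (1 : ℂ)).prod *
      ket (display n fun i k => if i = p ∧ S k = true then o k else y i k) (display n w) := by
  classical
  have hiff : ((∀ j ∈ cols n S, w p j = o j) ∧
      ∀ i < 12, ∀ k < n + 4, (i = p ∧ k ∈ cols n S) ∨ w i k = y i k) ↔
      ∀ i < 12, ∀ k < n + 4, w i k = if i = p ∧ S k = true then o k else y i k := by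
    constructor
    · rintro ⟨h1, h2⟩ i hi k hk
      split_ifs with h
      · rw [h.1, h1 k (mem_cols.2 ⟨hS k h.2, h.2⟩)]
      · exact (h2 i hi k hk).resolve_left fun h' => h ⟨h'.1, (mem_cols.1 h'.2).2⟩
    · intro h
      constructor
      · intro j hj
        obtain ⟨hj1, hj2⟩ := mem_cols.1 hj
        rw [h p hp j (by omega), if_pos ⟨rfl, hj2⟩]
      · intro i hi k hk
        by_cases h' : i = p ∧ S k = true
        · exact .inl ⟨h'.1, mem_cols.2 ⟨hS k h'.2, h'.2⟩⟩
        · right; rw [h i hi k hk, if_neg h']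
  rw [ket_display, hadamard]
  by_cases h1 : ∀ j ∈ cols n S, w p j = o j
  · by_cases h2 : ∀ i < 12, ∀ k < n + 4, (i = p ∧ k ∈ cols n S) ∨ w i k = y i k
    · rw [if_pos h1, if_pos h2, if_pos (hiff.1 ⟨h1, h2⟩), mul_one]
      congr 2
      apply List.map_congr_left
      intro j hj
      rw [h1 j hj]
    · rw [if_pos h1, if_neg h2, if_neg fun h => h2 (hiff.2 h).2, mul_zero]
  · rw [if_neg h1, if_neg fun h => h1 (hiff.2 h).1, mul_zero]

theorem rowAct_smul {n : ℕ} (o : Site n → Bool) (S : ℕ → Bool) (g : ℕ → Gate (Site n)) (α : ℂ)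
    (ψ : State (Site n)) : rowAct n o S g (α • ψ) = α • rowAct n o S g ψ :=
  foldl_act_smul o _ α ψ

theorem cols_last (n : ℕ) (b : Bool) :
    cols n (fun j => decide (j = n + 2) && b) = if b then [n + 2] else [] := by
  cases b
  · simp [cols]
  · rw [cols, List.range_succ, List.filter_append]
    have : (List.range (n + 2)).filter (fun j => decide (j = n + 2) && true) = [] := by
      rw [List.filter_eq_nil_iff]
      intro j hj
      have := List.mem_range.1 hj
      simp; omega
    rw [this]
    simp

/-! ### Erasing copies of a bit -/

/-- Four timesteps, the first with the number `t`, that erase copies of the bit `(z + 1, n + 2)`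
from row `p`: measure the copies in the conjugate basis, reset them, and compensate the resulting
sign on the original bit. -/
def eraseProg (n t p : ℕ) (S : ℕ → Bool) (z : ℕ) : List (List (Instr (Site n))) :=
  [hStep n p S, measureStep n p S,
    rowStep n S (fun j => .outcome (t + 1) (site n p j)) fun j => .X (site n p j),
    rowStep n (fun j => decide (j = n + 2))
      (fun _ => parityCond ((cols n S).map fun j => .outcome (t + 1) (site n p j)))
      fun j => .Z (site n (z + 1) j)]

/-- The effect of `eraseProg` on the contents. -/
def eraseApp (p : ℕ) (S : ℕ → Bool) (w : Grid) : Grid := fun i k =>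
  if i = p ∧ S k = true then false else w i k

theorem sign_cancel (L : List ℕ) (o : ℕ → Bool) (V : Type) (r : Record V) (s : ℕ) (v : ℕ → V)
    (ho : ∀ j, r s (v j) = o j) (c : Bool) :
    (L.map fun j => if o j && c then -1 else (1 : ℂ)).prod *
      (if (parityCond (L.map fun j => Cond.outcome s (v j))).eval r && c then -1 else 1) = 1 := by
  induction L with
  | nil => simp [parityCond, Cond.eval]
  | cons j L ih =>
    have : (parityCond ((j :: L).map fun j => Cond.outcome s (v j))).eval r =
        xor (o j) ((parityCond (L.map fun j => Cond.outcome s (v j))).eval r) := by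
      simp [parityCond, Cond.eval, ho]
    rw [this, List.map_cons, List.prod_cons]
    revert ih
    cases o j <;> cases c <;>
      cases (parityCond (L.map fun j => Cond.outcome s (v j))).eval r <;> simp

theorem exec_eraseProg {n p z : ℕ} (r : Record (Site n)) (t : ℕ) {S : ℕ → Bool}
    (hS : ∀ j, S j = true → j < n + 3) (hp : p < 12) (hz : z + 1 < 12)
    (hsrc : ¬(z + 1 = p ∧ S (n + 2) = true)) (y : Grid)
    (hy : ∀ j, S j = true → y p j = y (z + 1) (n + 2)) :
    exec r t (eraseProg n t p S z) (ket (display n y)) =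
      hAmp ^ (cols n S).length • ket (display n (eraseApp p S y)) := by
  simp only [eraseProg, hStep, measureStep, exec_rowStep, Cond.eval, Bool.and_true, exec_nil]
  set o : ℕ → Bool := fun j => r (t + 1) (site n p j) with ho
  set c := y (z + 1) (n + 2) with hc
  set s : ℂ := ((cols n S).map fun j => if o j && c then -1 else (1 : ℂ)).prod with hs
  set y' : Grid := fun i k => if i = p ∧ S k = true then o k else y i k with hy'
  have h1 : rowAct n (r (t + 1)) S (fun j => .MeasureZ (site n p j))
      (rowAct n (r t) S (fun j => .H (site n p j)) (ket (display n y))) =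
      (hAmp ^ (cols n S).length * s) • ket (display n y') := by
    refine state_ext fun w => ?_
    rw [rowAct_measure _ S hp, rowAct_H _ S hp, measured_hadamard hS hp o]
    simp only [Pi.smul_apply, smul_eq_mul]
    congr 2
    rw [hs]
    congr 1
    apply List.map_congr_left
    intro j hj
    rw [hy j (mem_cols.1 hj).2]
  rw [h1, rowAct_smul, rowAct_X_ket _ (fun j hj => hS j (by simp_all)) hp, rowAct_smul]
  have h2 : flipApp p (fun j => S j && r (t + 1) (site n p j)) y' = eraseApp p S y := by
    funext i k
    simp only [flipApp, eraseApp, hy', ho]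
    by_cases hi : i = p <;> cases S k <;> cases r (t + 1) (site n p k) <;> simp [hi]
  rw [h2, mul_smul]
  congr 1
  refine state_ext fun w => ?_
  rw [Pi.smul_apply, rowAct_Z _ _ hz, cols_last, smul_eq_mul]
  by_cases hw : display n w = display n (eraseApp p S y)
  · have hwc : w (z + 1) (n + 2) = c := by
      rw [display_eq_iff.1 hw (z + 1) hz (n + 2) (by omega), eraseApp, if_neg hsrc]
    have := sign_cancel (cols n S) o _ r (t + 1) (site n p) (fun _ => rfl) c
    rw [← hs] at this
    rw [← mul_assoc]
    refine (congrArg (· * _) ?_).trans (one_mul _)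
    refine Eq.trans ?_ this
    congr 1
    cases (parityCond ((cols n S).map fun j => Cond.outcome (t + 1) (site n p j))).eval r <;>
      simp [hwc]
  · have : ket (display n (eraseApp p S y)) (display n w) = 0 := by rw [ket, if_neg hw]
    rw [this]
    simp

/-! ### Fan-out of a bit along a row -/

/-- Six timesteps, the first with the number `t`, that copy the bit `(z + 1, n + 2)` to the
columns `0, …, n + 1` of row `z + 1`. In each column an entangled pair is prepared in the rows
`z` and `z + 1`, and a measurement joins it to the pair on its right; the outcomes tell which of
the copies are inverted. -/
def fanProg (n t z : ℕ) : List (List (Instr (Site n))) :=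
  [hStep n z (full n), cnotStep n z (z + 1) 0 0 (full n), cnotStep n (z + 1) z 1 0 (full n),
    measureStep n z (full n),
    rowStep n (full n) (fun j => .outcome (t + 3) (site n z j)) fun j => .X (site n z j),
    rowStep n (full n) (fun j => parityCond
      ((List.range' j (n + 2 - j)).map fun i => .outcome (t + 3) (site n z i)))
      fun j => .X (site n (z + 1) j)]

/-- The effect of `fanProg` on the contents. -/
def fanApp (n z : ℕ) (w : Grid) : Grid := fun i k =>
  if i = z + 1 ∧ full n k = true then w (z + 1) (n + 2) else w i k

theorem exec_fanProg {n z : ℕ} (r : Record (Site n)) (t : ℕ) (hz : z + 1 < 12) (y : Grid)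
    (hy0 : ∀ j < n + 2, y z j = false) (hy1 : ∀ j < n + 2, y (z + 1) j = false) :
    exec r t (fanProg n t z) (ket (display n y)) =
      hAmp ^ (cols n (full n)).length • ket (display n (fanApp n z y)) := by
  classical
  simp only [fanProg, hStep, cnotStep, measureStep, exec_rowStep, Cond.eval, Bool.and_true,
    exec_nil]
  set o : ℕ → Bool := fun j => r (t + 3) (site n z j) with ho
  set P : ℕ → Bool := fun j => (parityCond ((List.range' j (n + 2 - j)).map fun i =>
    Cond.outcome (t + 3) (site n z i))).eval r with hP
  set c := y (z + 1) (n + 2) with hc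
  have hP0 : P (n + 2) = false := by simp [hP, parityCond, Cond.eval]
  have hP1 : ∀ j < n + 2, P j = xor (o j) (P (j + 1)) := by
    intro j hj
    have : n + 2 - j = (n + 2 - (j + 1)) + 1 := by omega
    simp only [hP, this, List.range'_succ, List.map_cons, parityCond, List.foldr_cons, Cond.eval,
      ho]
  set y' : Grid := fun i k => if i = z ∧ full n k = true then o k else
    if i = z + 1 ∧ full n k = true then xor c (P k) else y i k with hy'
  have hfull : ∀ {k}, full n k = true ↔ k < n + 2 := by simp [full]
  have h1 : rowAct n (r (t + 1 + 1 + 1)) (full n) (fun j => .MeasureZ (site n z j))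
      (rowAct n (r (t + 1 + 1)) (full n)
        (fun j => .CNOT (site n (z + 1) (j + 1)) (site n z (j + 0)))
        (rowAct n (r (t + 1)) (full n) (fun j => .CNOT (site n z (j + 0)) (site n (z + 1) (j + 0)))
          (rowAct n (r t) (full n) (fun j => .H (site n z j)) (ket (display n y))))) =
      hAmp ^ (cols n (full n)).length • ket (display n y') := by
    refine state_ext fun w => ?_
    rw [rowAct_measure _ _ (by omega), rowAct_cnot _ full_lt hz (by omega) (by omega) (by omega)
      (by omega), rowAct_cnot _ full_lt (by omega) hz (by omega) (by omega) (by omega),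
      rowAct_H _ _ (by omega), hadamard, Pi.smul_apply, smul_eq_mul, ket_display]
    have hprod : ∀ w : Grid, ((cols n (full n)).map fun j =>
        if w z j && y z j then -1 else (1 : ℂ)).prod = 1 := by
      intro w
      apply List.prod_eq_one
      intro x hx
      obtain ⟨j, hj, rfl⟩ := List.mem_map.1 hx
      simp [hy0 j (hfull.1 (mem_cols.1 hj).2)]
    rw [hprod, mul_one]
    have hiff : ((∀ j ∈ cols n (full n), w z j = o j) ∧
        ∀ i < 12, ∀ k < n + 4, (i = z ∧ k ∈ cols n (full n)) ∨
          cnotApp z (z + 1) 0 0 (full n) (cnotApp (z + 1) z 1 0 (full n) w) i k = y i k) ↔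
        ∀ i < 12, ∀ k < n + 4, w i k = y' i k := by
      have hmem : ∀ {k}, k ∈ cols n (full n) ↔ k < n + 2 := fun {k} =>
        ⟨fun h => hfull.1 (mem_cols.1 h).2, fun h => mem_cols.2 ⟨by omega, hfull.2 h⟩⟩
      simp only [hmem]
      have hval : ∀ i k, ¬(i = z ∧ k < n + 2) →
          cnotApp z (z + 1) 0 0 (full n) (cnotApp (z + 1) z 1 0 (full n) w) i k =
          if i = z + 1 ∧ k < n + 2 then xor (w i k) (xor (w z k) (w (z + 1) (k + 1)))
            else w i k := by
        intro i k hik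
        by_cases hk : k < n + 2
        · have hiz : i ≠ z := fun h => hik ⟨h, hk⟩
          by_cases hi : i = z + 1 <;> simp [cnotApp, hfull, hk, hi, hiz]
        · simp [cnotApp, hfull, hk]
      constructor
      · rintro ⟨h1, h2⟩
        have h3 : ∀ i < 12, ∀ k < n + 4, ¬(i = z ∧ k < n + 2) → ¬(i = z + 1 ∧ k < n + 2) →
            w i k = y i k := by
          intro i hi k hk hik hik'
          have := (h2 i hi k hk).resolve_left hik
          rwa [hval i k hik, if_neg hik'] at this
        -- The outcomes determine the copies from right to left, beginning with the original bit.
        have h4 : ∀ m, m ≤ n + 2 → w (z + 1) (n + 2 - m) = xor c (P (n + 2 - m)) := by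
          intro m
          induction m with
          | zero =>
            intro _
            rw [Nat.sub_zero, h3 (z + 1) hz (n + 2) (by omega) (by omega) (by omega), hP0,
              Bool.xor_false]
          | succ m ih =>
            intro hm
            have ih := ih (by omega)
            have e : n + 2 - m = n + 2 - (m + 1) + 1 := by omega
            rw [e] at ih
            have hk : n + 2 - (m + 1) < n + 2 := by omega
            generalize n + 2 - (m + 1) = k at *
            have := (h2 (z + 1) hz k (by omega)).resolve_left (by omega)
            rw [hval _ _ (by omega), if_pos ⟨rfl, hk⟩, hy1 k hk, h1 k hk, ih] at this
            rw [hP1 k hk]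
            revert this
            cases w (z + 1) k <;> cases c <;> cases o k <;> cases P (k + 1) <;> simp
        intro i hi k hk
        simp only [hy', hfull]
        split_ifs with h5 h6
        · rw [h5.1, h1 k h5.2]
        · have := h4 (n + 2 - k) (by omega)
          rw [Nat.sub_sub_self h6.2.le] at this
          rw [h6.1, this]
        · exact h3 i hi k hk h5 h6
      · intro h
        simp only [hy', hfull] at h
        refine ⟨fun j hj => ?_, fun i hi k hk => ?_⟩
        · rw [h z (by omega) j (by omega), if_pos ⟨rfl, hj⟩]
        · by_cases hik : i = z ∧ k < n + 2
          · exact .inl hik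
          · right
            rw [hval i k hik]
            split_ifs with h5
            · rw [h5.1, h (z + 1) hz k hk, h z (by omega) k hk, h (z + 1) hz (k + 1) (by omega),
                if_neg (by omega), if_pos ⟨rfl, h5.2⟩, if_pos ⟨rfl, h5.2⟩, if_neg (by omega),
                hy1 k h5.2, hP1 k h5.2]
              by_cases hk2 : k + 1 < n + 2
              · rw [if_pos ⟨rfl, hk2⟩]
                cases c <;> cases o k <;> cases P (k + 1) <;> rfl
              · have : k + 1 = n + 2 := by omega
                rw [if_neg (by omega), this, hP0, ← hc]
                cases c <;> cases o k <;> rfl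
            · rw [h i hi k hk, if_neg hik, if_neg h5]
    by_cases h1 : ∀ j ∈ cols n (full n), w z j = o j
    · by_cases h2 : ∀ i < 12, ∀ k < n + 4, (i = z ∧ k ∈ cols n (full n)) ∨
          cnotApp z (z + 1) 0 0 (full n) (cnotApp (z + 1) z 1 0 (full n) w) i k = y i k
      · rw [if_pos h1, if_pos h2, if_pos (hiff.1 ⟨h1, h2⟩), mul_one]
      · rw [if_pos h1, if_neg h2, if_neg fun h => h2 (hiff.2 h).2, mul_zero]
    · rw [if_neg (by exact h1), if_neg fun h => h1 (hiff.2 h).1, mul_zero]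
  rw [h1, rowAct_smul, rowAct_X_ket _ (fun j hj => full_lt j (by simp_all)) (by omega),
    rowAct_smul, rowAct_X_ket _ (fun j hj => full_lt j (by simp_all)) (by omega)]
  congr 3
  funext i k
  simp only [flipApp, fanApp, hy']
  by_cases hk : full n k = true
  · by_cases hi : i = z
    · subst hi
      simp [hk, hy0 k (hfull.1 hk), ho]
    · by_cases hi' : i = z + 1
      · subst hi'
        have hPk : (parityCond ((List.range' k (n + 2 - k)).map fun i =>
          Cond.outcome (t + 3) (site n z i))).eval r = P k := rfl
        simp only [hk, hPk, hi, Bool.true_and, true_and, if_true, if_false, false_and,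
          and_self, ← hc]
        cases c <;> cases P k <;> rfl
      · simp [hi, hi']
  · simp [hk]

/-! ### Commands -/

/-- The building blocks of the circuit. A mask `S` selects the columns on which a block acts. -/
inductive Cmd where
  /-- CNOT gates with controls `(p, j + d)` and targets `(q, j + e)` -/
  | cnot (p q d e : ℕ) (S : ℕ → Bool) : Cmd
  /-- Toffoli gates from the rows `p` and `p + 1` to the row `p + 2` -/
  | tof (p : ℕ) (S : ℕ → Bool) : Cmd
  /-- copies of the bit `(z + 1, n + 2)` are written into the row `z` -/
  | load (z : ℕ) (S : ℕ → Bool) : Cmd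
  /-- copies of the bit `(z + 1, n + 2)` are erased from the row `z` -/
  | unload (z : ℕ) (S : ℕ → Bool) : Cmd

namespace Cmd

/-- The timesteps of a command, the first of which has the number `t`. -/
def prog (n t : ℕ) : Cmd → List (List (Instr (Site n)))
  | cnot p q d e S => [cnotStep n p q d e S]
  | tof p S => tofProg n p S
  | load z S => fanProg n t z ++
      (cnotStep n (z + 1) z 0 0 S :: eraseProg n (t + 7) (z + 1) (full n) z)
  | unload z S => eraseProg n t z S z

/-- The number of timesteps of a command. -/
def len : Cmd → ℕ
  | cnot .. => 1
  | tof .. => 17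
  | load .. => 11
  | unload .. => 4

theorem length_prog (n t : ℕ) (c : Cmd) : (c.prog n t).length = c.len := by cases c <;> rfl

/-- The effect of a command on the contents. -/
def app (n : ℕ) : Cmd → Grid → Grid
  | cnot p q d e S, w => cnotApp p q d e S w
  | tof p S, w => tofApp p S w
  | load z S, w => fun i k =>
      if i = z ∧ S k = true then xor (w i k) (w (z + 1) (n + 2)) else w i k
  | unload z S, w => fun i k =>
      if i = z ∧ S k = true then xor (w i k) (w (z + 1) (n + 2)) else w i k

/-- The contents on which a command has its effect: fan-out needs two empty rows, and only copies
can be erased. -/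
def Pre (n : ℕ) : Cmd → Grid → Prop
  | load z _, w => ∀ j < n + 2, w z j = false ∧ w (z + 1) j = false
  | unload z S, w => ∀ j, S j = true → w z j = w (z + 1) (n + 2)
  | _, _ => True

/-- A command acts on qubits of the grid and along its edges. -/
def Valid (n : ℕ) : Cmd → Prop
  | cnot p q d e S => p < 12 ∧ q < 12 ∧
      (q = p + 1 ∧ d = 0 ∧ e ≤ 1 ∨ p = q + 1 ∧ e = 0 ∧ d ≤ 1) ∧ ∀ j, S j = true → j < n + 3
  | tof p S => p + 2 < 12 ∧ ∀ j, S j = true → j < n + 3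
  | load z S => z + 1 < 12 ∧ ∀ j, S j = true → j < n + 2
  | unload z S => z + 1 < 12 ∧ ∀ j, S j = true → j < n + 2

theorem exec_prog {n : ℕ} (r : Record (Site n)) (t : ℕ) (c : Cmd) (hc : c.Valid n) :
    ∃ α : ℂ, ∀ w, c.Pre n w →
      exec r t (c.prog n t) (ket (display n w)) = α • ket (display n (c.app n w)) := by
  cases c with
  | cnot p q d e S =>
    obtain ⟨hp, hq, h, hS⟩ := hc
    refine ⟨1, fun w _ => ?_⟩
    simp only [prog, cnotStep, exec_rowStep, Cond.eval, Bool.and_true, exec_nil]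
    rw [rowAct_cnot_ket _ hS hp hq (by omega) (by omega) (by omega), one_smul]
    rfl
  | tof p S =>
    exact ⟨1, fun w _ => by rw [prog, exec_tofProg r t hc.2 hc.1, one_smul]; rfl⟩
  | load z S =>
    obtain ⟨hz, hS⟩ := hc
    refine ⟨hAmp ^ (cols n (full n)).length * hAmp ^ (cols n (full n)).length, fun w hw => ?_⟩
    have hS' : ∀ j, S j = true → j < n + 3 := fun j hj => by have := hS j hj; omega
    have hfull : ∀ j, full n j = true ↔ j < n + 2 := by simp [full]
    rw [prog, exec_append, exec_fanProg r t hz w (fun j hj => (hw j hj).1)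
      (fun j hj => (hw j hj).2), exec_smul, cnotStep, exec_rowStep]
    simp only [Cond.eval, Bool.and_true]
    rw [rowAct_cnot_ket _ hS' hz (by omega) (by omega) (by omega) (by omega)]
    have key := exec_eraseProg r (t + 7) (S := full n) (p := z + 1) (z := z) full_lt hz hz
      (by simp [full]) (cnotApp (z + 1) z 0 0 S (fanApp n z w))
      (by intro j hj; simp [cnotApp, fanApp, hj, hfull])
    rw [show t + (fanProg n t z).length + 1 = t + 7 from rfl, key, smul_smul]
    congr 3
    funext i k
    have h1 : ∀ k, S k = true → full n k = true := fun k hk => (hfull k).2 (hS k hk)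
    simp only [eraseApp, cnotApp, fanApp, app]
    by_cases hk : full n k = true
    · have h2 := (hw k ((hfull k).1 hk)).2
      by_cases hi : i = z
      · subst hi; simp [hk]
      · by_cases hi' : i = z + 1
        · subst hi'; simp [hk, h2]
        · simp [hi, hi']
    · have h3 : ¬S k = true := fun h => hk (h1 k h)
      simp [hk, h3]
  | unload z S =>
    obtain ⟨hz, hS⟩ := hc
    refine ⟨hAmp ^ (cols n S).length, fun w hw => ?_⟩
    rw [prog, exec_eraseProg r t (fun j hj => by have := hS j hj; omega) (by omega) hz
      (by omega) w hw]
    congr 3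
    funext i k
    simp only [eraseApp, app]
    split_ifs with h
    · rw [h.1, hw k h.2, Bool.xor_self]
    · rfl

/-- The command with the opposite effect. -/
def inv : Cmd → Cmd
  | load z S => unload z S
  | c => c

/-- A command other than `unload` that acts on the rows `0, …, 9` only. -/
def Low : Cmd → Prop
  | cnot p q _ _ _ => p < 10 ∧ q < 10 ∧ p ≠ q
  | tof p _ => p + 2 < 10
  | load z _ => z + 1 < 10
  | unload _ _ => False

end Cmd

/-- The content `w` with the words `u` and `v` in the rows 10 and 11. -/
def withOutput (u v : ℕ → Bool) (w : Grid) : Grid := fun i k =>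
  if i = 10 then u k else if i = 11 then v k else w i k

theorem withOutput_of_lt {u v : ℕ → Bool} {w : Grid} {i : ℕ} (hi : i < 10) (k : ℕ) :
    withOutput u v w i k = w i k := by
  rw [withOutput, if_neg (by omega), if_neg (by omega)]

namespace Cmd

theorem app_of_le {n : ℕ} {c : Cmd} (hc : c.Low) (w : Grid) {i : ℕ} (hi : 10 ≤ i) (k : ℕ) :
    c.app n w i k = w i k := by
  cases c with
  | cnot p q d e S => exact if_neg fun h => by have := hc.2.1; omega
  | tof p S => exact if_neg fun h => by have : p + 2 < 10 := hc; omega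
  | load z S => exact if_neg fun h => by have : z + 1 < 10 := hc; omega
  | unload z S => exact hc.elim

theorem app_withOutput {n : ℕ} {c : Cmd} (hc : c.Low) (u v : ℕ → Bool) (w : Grid) :
    c.app n (withOutput u v w) = withOutput u v (c.app n w) := by
  funext i k
  by_cases hi : i < 10
  · rw [withOutput_of_lt hi]
    cases c with
    | cnot p q d e S =>
      simp only [app, cnotApp, withOutput_of_lt hi, withOutput_of_lt hc.1]
    | tof p S =>
      have hc' : p + 2 < 10 := hc
      simp only [app, tofApp, withOutput_of_lt hi, withOutput_of_lt (show p < 10 by omega),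
        withOutput_of_lt (show p + 1 < 10 by omega)]
    | load z S =>
      have hc' : z + 1 < 10 := hc
      simp only [app, withOutput_of_lt hi, withOutput_of_lt hc']
    | unload z S => exact hc.elim
  · rw [app_of_le hc _ (by omega)]
    simp only [withOutput, app_of_le hc w (show 10 ≤ i by omega)]

theorem inv_app_app {n : ℕ} {c : Cmd} (hc : c.Low) (w : Grid) :
    c.inv.app n (c.app n w) = w := by
  cases c with
  | cnot p q d e S => exact cnotApp_cnotApp hc.2.2 d e S w
  | tof p S =>
    funext i k
    simp only [inv, app, tofApp]
    by_cases h : i = p + 2 ∧ S k = true <;> simp [h]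
  | load z S =>
    funext i k
    simp only [inv, app]
    by_cases h : i = z ∧ S k = true <;> simp [h]
  | unload z S => exact hc.elim

theorem inv_pre {n : ℕ} {c : Cmd} (hc : c.Low) (hv : c.Valid n) (u v : ℕ → Bool) {w : Grid}
    (hw : c.Pre n w) : c.inv.Pre n (withOutput u v (c.app n w)) := by
  cases c with
  | cnot p q d e S => trivial
  | tof p S => trivial
  | load z S =>
    intro j hj
    have hc' : z + 1 < 10 := hc
    rw [withOutput_of_lt (by omega), withOutput_of_lt hc']
    simp [app, hj, (hw j (hv.2 j hj)).1]
  | unload z S => exact hc.elim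

theorem inv_inv_app {n : ℕ} {c : Cmd} (hc : c.Low) (u v : ℕ → Bool) (w : Grid) :
    c.inv.app n (withOutput u v (c.app n w)) = withOutput u v w := by
  rw [← app_withOutput hc, inv_app_app hc]

theorem inv_valid {n : ℕ} {c : Cmd} (hv : c.Valid n) : c.inv.Valid n := by
  cases c <;> exact hv

end Cmd

/-! ### Programs -/

/-- The timesteps of a list of commands, the first of which has the number `t`. -/
def compile (n : ℕ) : ℕ → List Cmd → List (List (Instr (Site n)))
  | _, [] => []
  | t, c :: cs => c.prog n t ++ compile n (t + c.len) cs

/-- The number of timesteps of a list of commands. -/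
def totalLen (cs : List Cmd) : ℕ := (cs.map Cmd.len).sum

theorem totalLen_append (cs ds : List Cmd) :
    totalLen (cs ++ ds) = totalLen cs + totalLen ds := by simp [totalLen]

theorem length_compile (n : ℕ) (cs : List Cmd) :
    ∀ t, (compile n t cs).length = totalLen cs := by
  induction cs with
  | nil => intro t; rfl
  | cons c cs ih => intro t; simp [compile, ih, Cmd.length_prog, totalLen]

theorem compile_append (n : ℕ) (cs ds : List Cmd) :
    ∀ t, compile n t (cs ++ ds) = compile n t cs ++ compile n (t + totalLen cs) ds := by
  induction cs with
  | nil => intro t; rfl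
  | cons c cs ih => intro t; simp [compile, ih, totalLen, Nat.add_assoc]

/-- The effect of a list of commands on the contents. -/
def apps (n : ℕ) (cs : List Cmd) (w : Grid) : Grid := cs.foldl (fun w c => c.app n w) w

theorem apps_append (n : ℕ) (cs ds : List Cmd) (w : Grid) :
    apps n (cs ++ ds) w = apps n ds (apps n cs w) := by simp [apps]

theorem apps_cons (n : ℕ) (c : Cmd) (cs : List Cmd) (w : Grid) :
    apps n (c :: cs) w = apps n cs (c.app n w) := rfl

/-- Every command of the list finds the contents that it needs. -/
def Pres (n : ℕ) : List Cmd → Grid → Prop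
  | [], _ => True
  | c :: cs, w => c.Pre n w ∧ Pres n cs (c.app n w)

theorem pres_append (n : ℕ) (cs ds : List Cmd) :
    ∀ w, Pres n (cs ++ ds) w ↔ Pres n cs w ∧ Pres n ds (apps n cs w) := by
  induction cs with
  | nil => intro w; simp [Pres, apps]
  | cons c cs ih => intro w; simp [Pres, ih, apps, and_assoc]

/-- On basis states, a list of commands acts as its effect on the contents says, up to a factor
that does not depend on the content. -/
theorem exec_compile {n : ℕ} (r : Record (Site n)) (cs : List Cmd) :
    ∀ t, (∀ c ∈ cs, c.Valid n) → ∃ α : ℂ, ∀ w, Pres n cs w →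
      exec r t (compile n t cs) (ket (display n w)) = α • ket (display n (apps n cs w)) := by
  induction cs with
  | nil => intro t _; exact ⟨1, fun w _ => by rw [one_smul]; rfl⟩
  | cons c cs ih =>
    intro t h
    obtain ⟨α, hα⟩ := c.exec_prog r t (h c List.mem_cons_self)
    obtain ⟨β, hβ⟩ := ih (t + c.len) fun d hd => h d (List.mem_cons_of_mem _ hd)
    refine ⟨α * β, fun w hw => ?_⟩
    rw [compile, exec_append, hα w hw.1, exec_smul, Cmd.length_prog, hβ _ hw.2, smul_smul,
      apps_cons]

/-- The commands that undo a list of commands. -/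
def undo (cs : List Cmd) : List Cmd := (cs.map Cmd.inv).reverse

theorem undo_apps {n : ℕ} (u v : ℕ → Bool) (cs : List Cmd) (hlow : ∀ c ∈ cs, c.Low)
    (hv : ∀ c ∈ cs, c.Valid n) : ∀ w, Pres n cs w →
      Pres n (undo cs) (withOutput u v (apps n cs w)) ∧
        apps n (undo cs) (withOutput u v (apps n cs w)) = withOutput u v w := by
  induction cs with
  | nil => intro w _; exact ⟨trivial, rfl⟩
  | cons c cs ih =>
    intro w hw
    have hc := hlow c List.mem_cons_self
    have := ih (fun d hd => hlow d (List.mem_cons_of_mem _ hd))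
      (fun d hd => hv d (List.mem_cons_of_mem _ hd)) _ hw.2
    have e : undo (c :: cs) = undo cs ++ [c.inv] := by simp [undo]
    rw [e, pres_append, apps_append, apps_cons, this.2]
    exact ⟨⟨this.1, Cmd.inv_pre hc (hv c List.mem_cons_self) u v hw.1, trivial⟩,
      Cmd.inv_inv_app hc u v w⟩

theorem undo_valid {n : ℕ} {cs : List Cmd} (hv : ∀ c ∈ cs, c.Valid n) :
    ∀ c ∈ undo cs, c.Valid n := by
  intro c hc
  obtain ⟨d, hd, rfl⟩ := List.mem_map.1 (List.mem_reverse.1 hc)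
  exact Cmd.inv_valid (hv d hd)

theorem apps_of_le {n : ℕ} {cs : List Cmd} (hlow : ∀ c ∈ cs, c.Low) (w : Grid) {i : ℕ}
    (hi : 10 ≤ i) (k : ℕ) : apps n cs w i k = w i k := by
  induction cs generalizing w with
  | nil => rfl
  | cons c cs ih =>
    rw [apps_cons, ih (fun d hd => hlow d (List.mem_cons_of_mem _ hd)),
      Cmd.app_of_le (hlow c List.mem_cons_self) w hi]

/-! ### The rules for circuits -/

/-- A list of instructions that may be used as timestep number `t`: the rules for circuits, and
bounds for the number of gates and the size of their conditions. -/
structure GoodStep (n t : ℕ) (l : List (Instr (Site n))) : Prop where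
  allowed : ∀ i ∈ l, i.gate.Allowed (gridGraph n)
  causal : ∀ i ∈ l, i.cond.ReadsBefore t
  concurrent : ((l.map Instr.gate).flatMap Gate.qubits).Nodup
  length_le : l.length ≤ n + 3
  size_le : ∀ i ∈ l, i.cond.size ≤ 2 * n + 7

theorem goodStep_rowStep {n t : ℕ} {S : ℕ → Bool} {c : ℕ → Cond (Site n)}
    {g : ℕ → Gate (Site n)}
    (hall : ∀ j < n + 3, S j = true → (g j).Allowed (gridGraph n))
    (hcaus : ∀ j < n + 3, S j = true → (c j).ReadsBefore t)
    (hsize : ∀ j < n + 3, S j = true → (c j).size ≤ 2 * n + 7)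
    (hnd : ∀ j < n + 3, (g j).qubits.Nodup)
    (hdisj : ∀ i < n + 3, ∀ j < n + 3, i ≠ j → (g i).qubits.Disjoint (g j).qubits) :
    GoodStep n t (rowStep n S c g) where
  allowed i hi := by
    obtain ⟨j, hj, rfl⟩ := List.mem_map.1 hi
    exact hall j (mem_cols.1 hj).1 (mem_cols.1 hj).2
  causal i hi := by
    obtain ⟨j, hj, rfl⟩ := List.mem_map.1 hi
    exact hcaus j (mem_cols.1 hj).1 (mem_cols.1 hj).2
  concurrent := by
    rw [rowStep, List.map_map, List.flatMap_map, List.nodup_flatMap]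
    refine ⟨fun j hj => hnd j (mem_cols.1 hj).1, ?_⟩
    refine List.Pairwise.imp_of_mem ?_ (nodup_cols n S)
    intro i j hi hj hij
    exact hdisj i (mem_cols.1 hi).1 j (mem_cols.1 hj).1 hij
  length_le := by
    rw [rowStep, List.length_map, cols]
    exact (List.length_filter_le _ _).trans (by simp)
  size_le i hi := by
    obtain ⟨j, hj, rfl⟩ := List.mem_map.1 hi
    exact hsize j (mem_cols.1 hj).1 (mem_cols.1 hj).2

/-- A row of one-qubit gates. -/
theorem goodStep_single {n t p : ℕ} {S : ℕ → Bool} {c : ℕ → Cond (Site n)}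
    {g : ℕ → Gate (Site n)} (hp : p < 12) (hg : ∀ j, (g j).qubits = [site n p j])
    (hall : ∀ j, (g j).Allowed (gridGraph n))
    (hcaus : ∀ j < n + 3, S j = true → (c j).ReadsBefore t)
    (hsize : ∀ j < n + 3, S j = true → (c j).size ≤ 2 * n + 7) :
    GoodStep n t (rowStep n S c g) := by
  refine goodStep_rowStep (fun j _ _ => hall j) hcaus hsize (fun j _ => by simp [hg]) ?_
  intro i hi j hj hij
  rw [hg, hg]
  simp only [List.disjoint_singleton]
  rw [List.mem_singleton, site_inj hp (by omega) hp (by omega)]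
  exact fun h => hij h.2.symm

theorem goodStep_cnotStep {n t p q d e : ℕ} {S : ℕ → Bool} (hp : p < 12) (hq : q < 12)
    (h : q = p + 1 ∧ d = 0 ∧ e ≤ 1 ∨ p = q + 1 ∧ e = 0 ∧ d ≤ 1) :
    GoodStep n t (cnotStep n p q d e S) := by
  refine goodStep_rowStep (fun j hj _ => ?_) (fun _ _ _ => trivial)
    (fun _ _ _ => by simp [Cond.size]) (fun j hj => ?_) ?_
  · rcases h with h | h
    · left
      rw [Below, site_fst _ hp, site_fst _ hq, site_snd _ (by omega), site_snd _ (by omega)]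
      omega
    · right
      rw [Below, site_fst _ hp, site_fst _ hq, site_snd _ (by omega), site_snd _ (by omega)]
      omega
  · simp only [Gate.qubits, List.nodup_cons, List.mem_singleton, List.not_mem_nil,
      not_false_eq_true, List.nodup_nil, and_true]
    rw [site_inj hp (by omega) hq (by omega)]
    omega
  · intro i hi j hj hij
    simp only [Gate.qubits, List.disjoint_cons_left, List.mem_cons, List.not_mem_nil, or_false,
      List.disjoint_nil_left, and_true]
    rw [site_inj hp (by omega) hp (by omega), site_inj hp (by omega) hq (by omega),
      site_inj hq (by omega) hp (by omega), site_inj hq (by omega) hq (by omega)]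
    omega

theorem parityCond_readsBefore {V : Type} {t : ℕ} {l : List (Cond V)}
    (h : ∀ c ∈ l, c.ReadsBefore t) : (parityCond l).ReadsBefore t := by
  induction l with
  | nil => trivial
  | cons c l ih =>
    exact ⟨h c List.mem_cons_self, ih fun d hd => h d (List.mem_cons_of_mem _ hd)⟩

theorem size_parityCond {V : Type} (s : ℕ) (l : List ℕ) (v : ℕ → V) :
    (parityCond (l.map fun j => Cond.outcome s (v j))).size = 2 * l.length + 1 := by
  induction l with
  | nil => rfl
  | cons j l ih =>
    have : (parityCond ((j :: l).map fun j => Cond.outcome s (v j))).size =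
        1 + (parityCond (l.map fun j => Cond.outcome s (v j))).size + 1 := rfl
    rw [this, ih, List.length_cons]
    ring

/-- A list of timesteps, the first with the number `t`, that obey the rules. -/
def GoodProg (n : ℕ) : ℕ → List (List (Instr (Site n))) → Prop
  | _, [] => True
  | t, l :: prog => GoodStep n t l ∧ GoodProg n (t + 1) prog

theorem goodProg_append {n : ℕ} (A B : List (List (Instr (Site n)))) :
    ∀ t, GoodProg n t (A ++ B) ↔ GoodProg n t A ∧ GoodProg n (t + A.length) B := by
  induction A with
  | nil => intro t; simp [GoodProg]
  | cons l A ih =>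
    intro t
    simp [GoodProg, ih, and_assoc, Nat.add_assoc, Nat.add_comm 1]

theorem GoodProg.goodStep {n : ℕ} {A : List (List (Instr (Site n)))} {s : ℕ}
    (h : GoodProg n s A) : ∀ (t : ℕ) (l : List (Instr (Site n))), A[t]? = some l →
      GoodStep n (s + t) l := by
  induction A generalizing s with
  | nil => intro t l hl; simp at hl
  | cons a A ih =>
    intro t l hl
    cases t with
    | zero =>
      simp only [List.getElem?_cons_zero, Option.some.injEq] at hl
      exact hl ▸ h.1
    | succ t =>
      rw [List.getElem?_cons_succ] at hl
      have := ih h.2 t l hl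
      rwa [Nat.add_assoc, Nat.add_comm 1] at this

theorem goodProg_eraseProg {n t p z : ℕ} {S : ℕ → Bool} (hp : p < 12) (hz : z + 1 < 12) :
    GoodProg n t (eraseProg n t p S z) := by
  refine ⟨?_, ?_, ?_, ?_, trivial⟩
  · exact goodStep_single hp (fun _ => rfl) (fun _ => trivial) (fun _ _ _ => trivial)
      (fun _ _ _ => by simp [Cond.size])
  · exact goodStep_single hp (fun _ => rfl) (fun _ => trivial) (fun _ _ _ => trivial)
      (fun _ _ _ => by simp [Cond.size])
  · exact goodStep_single hp (fun _ => rfl) (fun _ => trivial)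
      (fun _ _ _ => by simp [Cond.ReadsBefore]) (fun _ _ _ => by simp [Cond.size])
  · refine goodStep_single hz (fun _ => rfl) (fun _ => trivial) (fun _ _ _ => ?_)
      (fun _ _ _ => ?_)
    · apply parityCond_readsBefore
      intro c hc
      obtain ⟨j, -, rfl⟩ := List.mem_map.1 hc
      simp only [Cond.ReadsBefore]
      omega
    · rw [size_parityCond]
      have : (cols n S).length ≤ n + 3 := (List.length_filter_le _ _).trans (by simp)
      omega

theorem goodProg_fanProg {n t z : ℕ} (hz : z + 1 < 12) : GoodProg n t (fanProg n t z) := by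
  refine ⟨?_, ?_, ?_, ?_, ?_, ?_, trivial⟩
  · exact goodStep_single (by omega : z < 12) (fun _ => rfl) (fun _ => trivial)
      (fun _ _ _ => trivial) (fun _ _ _ => by simp [Cond.size])
  · exact goodStep_cnotStep (by omega) hz (by omega)
  · exact goodStep_cnotStep hz (by omega) (by omega)
  · exact goodStep_single (by omega : z < 12) (fun _ => rfl) (fun _ => trivial)
      (fun _ _ _ => trivial) (fun _ _ _ => by simp [Cond.size])
  · exact goodStep_single (by omega : z < 12) (fun _ => rfl) (fun _ => trivial)
      (fun _ _ _ => by simp only [Cond.ReadsBefore]; omega) (fun _ _ _ => by simp [Cond.size])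
  · refine goodStep_single hz (fun _ => rfl) (fun _ => trivial) (fun _ _ _ => ?_)
      (fun _ _ _ => ?_)
    · apply parityCond_readsBefore
      intro c hc
      obtain ⟨j, -, rfl⟩ := List.mem_map.1 hc
      simp only [Cond.ReadsBefore]
      omega
    · rw [size_parityCond, List.length_range']
      omega

theorem goodProg_prog {n t : ℕ} {c : Cmd} (hc : c.Valid n) : GoodProg n t (c.prog n t) := by
  cases c with
  | cnot p q d e S => exact ⟨goodStep_cnotStep hc.1 hc.2.1 hc.2.2.1, trivial⟩
  | tof p S =>
    have hp : p + 2 < 12 := hc.1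
    have h1 : ∀ {t q : ℕ} {g : ℕ → Gate (Site n)}, q < 12 →
        (∀ j, (g j).qubits = [site n q j]) → (∀ j, (g j).Allowed (gridGraph n)) →
        GoodStep n t (rowStep n S always g) := fun hq hg hall =>
      goodStep_single hq hg hall (fun _ _ _ => trivial) (fun _ _ _ => by simp [Cond.size])
    have hH : ∀ {t q : ℕ}, q < 12 → GoodStep n t (hStep n q S) := fun hq =>
      h1 hq (fun _ => rfl) fun _ => trivial
    have hT : ∀ {t q : ℕ}, q < 12 → GoodStep n t (tStep n q S) := fun hq =>
      h1 hq (fun _ => rfl) fun _ => trivial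
    have hTd : ∀ {t q : ℕ}, q < 12 → GoodStep n t (tdgStep n q S) := fun hq =>
      h1 hq (fun _ => rfl) fun _ => trivial
    have hAB : ∀ {t : ℕ}, GoodStep n t (cnotStep n p (p + 1) 0 0 S) := fun {t} =>
      goodStep_cnotStep (by omega) (by omega) (by omega)
    have hBC : ∀ {t : ℕ}, GoodStep n t (cnotStep n (p + 1) (p + 2) 0 0 S) := fun {t} =>
      goodStep_cnotStep (by omega) (by omega) (by omega)
    have hA : p < 12 := by omega
    have hB : p + 1 < 12 := by omega
    exact ⟨hH hp, hT hA, hT hB, hT hp, hBC, hTd hp, hAB, hTd hB, hBC, hTd hp, hAB, hBC, hT hp,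
      hAB, hBC, hAB, hH hp, trivial⟩
  | load z S =>
    have hz : z + 1 < 12 := hc.1
    rw [Cmd.prog, goodProg_append]
    exact ⟨goodProg_fanProg hz, goodStep_cnotStep hz (by omega) (by omega),
      goodProg_eraseProg hz hz⟩
  | unload z S =>
    have hz : z + 1 < 12 := hc.1
    exact goodProg_eraseProg (by omega) hz

theorem goodProg_compile {n : ℕ} {cs : List Cmd} :
    ∀ t, (∀ c ∈ cs, c.Valid n) → GoodProg n t (compile n t cs) := by
  induction cs with
  | nil => intro t _; trivial
  | cons c cs ih =>
    intro t h
    rw [compile, goodProg_append, Cmd.length_prog]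
    exact ⟨goodProg_prog (h c List.mem_cons_self),
      ih _ fun d hd => h d (List.mem_cons_of_mem _ hd)⟩

/-- The circuit that carries out a list of commands. -/
def circuit (n : ℕ) (cs : List Cmd) (hv : ∀ c ∈ cs, c.Valid n) : Circuit (Site n) where
  toLayout := gridLayout n
  steps := compile n 0 cs
  allowed l hl := by
    obtain ⟨t, ht⟩ := List.mem_iff_getElem?.1 hl
    exact ((goodProg_compile 0 hv).goodStep t l ht).allowed
  causal t l hl := by
    have := ((goodProg_compile 0 hv).goodStep t l hl).causal
    rwa [Nat.zero_add] at this
  concurrent l hl r := by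
    obtain ⟨t, ht⟩ := List.mem_iff_getElem?.1 hl
    have := ((goodProg_compile 0 hv).goodStep t l ht).concurrent
    exact this.sublist ((List.filter_sublist.map _).flatMap _)

theorem depth_circuit {n : ℕ} {cs : List Cmd} (hv : ∀ c ∈ cs, c.Valid n) :
    (circuit n cs hv).depth = totalLen cs := length_compile n cs 0

theorem goodStep_circuit {n : ℕ} {cs : List Cmd} (hv : ∀ c ∈ cs, c.Valid n) {t : ℕ}
    {l : List (Instr (Site n))} (hl : (circuit n cs hv).steps[t]? = some l) : GoodStep n t l := by
  have := (goodProg_compile 0 hv).goodStep t l hl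
  rwa [Nat.zero_add] at this

theorem size_circuit_le {n : ℕ} {cs : List Cmd} (hv : ∀ c ∈ cs, c.Valid n)
    (r : Record (Site n)) : (circuit n cs hv).size r ≤ totalLen cs * (n + 3) := by
  rw [Circuit.size, depth_circuit]
  refine (Finset.sum_le_card_nsmul _ _ (n + 3) fun t ht => ?_).trans (by simp)
  rw [Circuit.gatesAt, List.getD_eq_getElem?_getD]
  cases h : (circuit n cs hv).steps[t]? with
  | none => simp [fired]
  | some l =>
    rw [Option.getD_some, fired, List.length_map]
    exact (List.length_filter_le _ _).trans (goodStep_circuit hv h).length_le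

theorem controllerSize_circuit_le {n : ℕ} {cs : List Cmd} (hv : ∀ c ∈ cs, c.Valid n) :
    (circuit n cs hv).controllerSize ≤ totalLen cs * ((n + 3) * (2 * n + 7)) := by
  rw [Circuit.controllerSize, ← depth_circuit hv, Circuit.depth]
  refine (List.sum_le_card_nsmul _ ((n + 3) * (2 * n + 7)) ?_).trans (by simp)
  intro x hx
  obtain ⟨l, hl, rfl⟩ := List.mem_map.1 hx
  obtain ⟨t, ht⟩ := List.mem_iff_getElem?.1 hl
  have hgood := goodStep_circuit hv ht
  refine (List.sum_le_card_nsmul _ (2 * n + 7) ?_).trans ?_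
  · intro y hy
    obtain ⟨i, hi, rfl⟩ := List.mem_map.1 hy
    exact hgood.size_le i hi
  · rw [List.length_map, smul_eq_mul]
    exact Nat.mul_le_mul_right _ hgood.length_le

theorem width_circuit_le {n : ℕ} {cs : List Cmd} (hv : ∀ c ∈ cs, c.Valid n)
    (io : Set (Site n)) : (circuit n cs hv).width io ≤ 12 * (n + 4) := by
  rw [Circuit.width]
  refine (Set.ncard_le_card _).trans ?_
  simp

/-- The state of the circuit after the commands `cs`, the first of the commands `cs ++ ds`. -/
theorem run_circuit {n : ℕ} {cs ds : List Cmd} (hv : ∀ c ∈ cs ++ ds, c.Valid n)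
    (r : Record (Site n)) : ∃ α : ℂ, ∀ w, Pres n cs w →
      (circuit n (cs ++ ds) hv).run r (ket (display n w)) (totalLen cs) =
        α • ket (display n (apps n cs w)) := by
  obtain ⟨α, hα⟩ := exec_compile r cs 0 fun c hc => hv c (List.mem_append_left _ hc)
  refine ⟨α, fun w hw => ?_⟩
  rw [← length_compile n cs 0, run_eq_exec _ r _ (compile n 0 cs) _ (compile_append n cs ds 0),
    hα w hw]

/-! ### The carry-save layers as programs -/

/-- The parity of three bits. -/
def par3 (x y z : Bool) : Bool := xor (xor x y) z

/-- The majority of three bits. -/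
def maj3 (x y z : Bool) : Bool := (x && y) || (x && z) || (y && z)

/-- The mask of the columns `0, …, n`. -/
def body (n : ℕ) : ℕ → Bool := fun j => decide (j < n + 1)

/-- The mask of a single column. -/
def only (c : ℕ) : ℕ → Bool := fun j => decide (j = c)

/-- CNOT gates within the columns. -/
abbrev vert (p q : ℕ) (S : ℕ → Bool) : Cmd := .cnot p q 0 0 S

/-- CNOT gates from row `p` to the next row, one column to the right. -/
abbrev down (p : ℕ) (S : ℕ → Bool) : Cmd := .cnot p (p + 1) 0 1 S

/-- CNOT gates from row `p + 1` to the row before, one column to the left. -/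
abbrev up (p : ℕ) (S : ℕ → Bool) : Cmd := .cnot (p + 1) p 1 0 S

/-- A row of full adders: for words `x`, `y`, `z` in the rows `r`, `r + 1`, `r + 2` the parities
replace `z`, and the majorities are added to the row `r + 3`. They are computed as
`y + (x + y) * (y + z)`, with a single Toffoli gate. -/
def adder (r : ℕ) (S : ℕ → Bool) : List Cmd :=
  [vert (r + 2) (r + 3) S, vert (r + 1) (r + 2) S, vert (r + 2) (r + 3) S, vert r (r + 1) S,
    .tof (r + 1) S, vert r (r + 1) S, vert (r + 1) (r + 2) S, vert r (r + 1) S,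
    vert (r + 1) (r + 2) S]

/-- The majorities move from the row `r + 3` to the row `r + 4`, one column to the right. -/
def carry (n r : ℕ) : List Cmd := [down (r + 3) (full n), up (r + 3) (full n)]

/-- The shifted carry word moves back to the row `r + 3`, next to the parities. -/
def settle (n r : ℕ) : List Cmd := [vert (r + 4) (r + 3) (full n), vert (r + 3) (r + 4) (full n)]

/-- The bit `(i, c)` moves to the row `i + 1`. -/
def move (c i : ℕ) : List Cmd := [vert i (i + 1) (only c), vert (i + 1) i (only c)]

/-- The three overflow bits are brought to column `n + 2`, into the rows from which they are fanned
out later. -/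
def park (n : ℕ) : List Cmd :=
  move (n + 2) 4 ++ move (n + 2) 5 ++ move (n + 2) 6 ++ move (n + 2) 7 ++ move (n + 2) 8 ++
    [down 2 (only (n + 1))] ++
    move (n + 2) 3 ++ move (n + 2) 4 ++ move (n + 2) 5 ++ move (n + 2) 6 ++
    [down 4 (only (n + 1))]

/-- The results of the last layer are copied to the rows 10 and 11. -/
def output (n : ℕ) : List Cmd :=
  [down 9 (full n), vert 10 11 (full n), down 9 (full n), vert 9 10 (full n), vert 8 9 (full n),
    vert 9 10 (full n), vert 8 9 (full n)]

/-! ### The effect of the programs -/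

theorem full_iff {n j : ℕ} : full n j = true ↔ j < n + 2 := by simp [full]

theorem cnotApp_apply (p q d e : ℕ) (S : ℕ → Bool) (w : Grid) (i k : ℕ) :
    cnotApp p q d e S w i k =
      if i = q ∧ e ≤ k ∧ S (k - e) = true then xor (w i k) (w p (k - e + d)) else w i k := rfl

theorem tofApp_apply (p : ℕ) (S : ℕ → Bool) (w : Grid) (i k : ℕ) : tofApp p S w i k =
    if i = p + 2 ∧ S k = true then xor (w i k) (w p k && w (p + 1) k) else w i k := rfl

theorem apps_adder (n r : ℕ) (S : ℕ → Bool) (w : Grid) (i j : ℕ) :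
    apps n (adder r S) w i j =
      if S j = true then
        if i = r + 1 then xor (w r j) (w (r + 1) j)
        else if i = r + 2 then par3 (w r j) (w (r + 1) j) (w (r + 2) j)
        else if i = r + 3 then xor (w (r + 3) j) (maj3 (w r j) (w (r + 1) j) (w (r + 2) j))
        else w i j
      else w i j := by
  simp only [apps, adder, List.foldl_cons, List.foldl_nil, Cmd.app]
  by_cases hS : S j = true
  · by_cases h1 : i = r + 1
    · subst h1; simp [cnotApp_apply, tofApp_apply, hS, Nat.add_assoc]
      cases w r j <;> cases w (r + 1) j <;> rfl
    · by_cases h2 : i = r + 2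
      · subst h2; simp [cnotApp_apply, tofApp_apply, hS, par3, Nat.add_assoc]
        cases w r j <;> cases w (r + 1) j <;> cases w (r + 2) j <;> rfl
      · by_cases h3 : i = r + 3
        · subst h3; simp [cnotApp_apply, tofApp_apply, hS, maj3, Nat.add_assoc]
          cases w r j <;> cases w (r + 1) j <;> cases w (r + 2) j <;> cases w (r + 3) j <;> rfl
        · simp [cnotApp_apply, tofApp_apply, h1, h2, h3, Nat.add_assoc]
  · simp [cnotApp_apply, tofApp_apply, hS]

theorem apps_carry (n r : ℕ) (w : Grid) (i j : ℕ) :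
    apps n (carry n r) w i j =
      if i = r + 4 ∧ 1 ≤ j ∧ j < n + 3 then xor (w (r + 4) j) (w (r + 3) (j - 1))
      else if i = r + 3 ∧ j < n + 2 then w (r + 4) (j + 1)
      else w i j := by
  simp only [apps, carry, List.foldl_cons, List.foldl_nil, Cmd.app, cnotApp_apply, full_iff]
  by_cases h4 : i = r + 4
  · subst h4
    by_cases hj : 1 ≤ j
    · have : j - 1 < n + 2 ↔ j < n + 3 := by omega
      simp [hj, this]
    · simp [hj]
  · by_cases h3 : i = r + 3
    · subst h3
      by_cases hj : j < n + 2
      · simp [hj, Nat.add_assoc]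
        cases w (r + 3) j <;> simp
      · simp [hj]
    · simp [h3, h4]

theorem apps_settle (n r : ℕ) (w : Grid) (i j : ℕ) :
    apps n (settle n r) w i j =
      if i = r + 3 ∧ j < n + 2 then xor (w (r + 3) j) (w (r + 4) j)
      else if i = r + 4 ∧ j < n + 2 then w (r + 3) j
      else w i j := by
  simp only [apps, settle, List.foldl_cons, List.foldl_nil, Cmd.app, cnotApp_apply, full_iff]
  by_cases hj : j < n + 2
  · by_cases h3 : i = r + 3
    · subst h3; simp [hj]
    · by_cases h4 : i = r + 4
      · subst h4
        simp [hj]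
        cases w (r + 3) j <;> simp
      · simp [h3, h4]
  · simp [hj]

theorem apps_move (n c i : ℕ) (w : Grid) (i' j : ℕ) :
    apps n (move c i) w i' j =
      if j = c then
        if i' = i + 1 then xor (w (i + 1) c) (w i c)
        else if i' = i then w (i + 1) c else w i' c
      else w i' j := by
  simp only [apps, move, List.foldl_cons, List.foldl_nil, Cmd.app, cnotApp_apply, only]
  by_cases hj : j = c
  · subst hj
    by_cases h1 : i' = i + 1
    · subst h1; simp
    · by_cases h2 : i' = i
      · subst h2
        simp
        cases w i' j <;> simp
      · simp [h1, h2]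
  · simp [hj]

theorem apps_park_left (n : ℕ) (w : Grid) (i j : ℕ) (hj : j < n + 2) :
    apps n (park n) w i j = w i j := by
  have hmove : ∀ (w : Grid) (i' : ℕ), apps n (move (n + 2) i') w i j = w i j := by
    intro w i'
    have : j ≠ n + 2 := by omega
    simp [apps, move, Cmd.app, cnotApp_apply, only, this]
  have hdown : ∀ (w : Grid) (p : ℕ), apps n [down p (only (n + 1))] w i j = w i j := by
    intro w p
    have : j - 1 ≠ n + 1 := by omega
    simp [apps, Cmd.app, cnotApp_apply, only, this]
  simp only [park, apps_append, hmove, hdown]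

theorem apps_park_right (n : ℕ) (w : Grid) (hw : ∀ i < 12, i ≠ 4 → 3 ≤ i → w i (n + 2) = false)
    (i : ℕ) (h5 : 5 ≤ i) (hi : i < 12) :
    apps n (park n) w i (n + 2) = if i = 5 then w 4 (n + 1) else if i = 7 then w 2 (n + 1)
      else if i = 9 then w 4 (n + 2) else false := by
  have hdown : ∀ (w : Grid) (p i j : ℕ), apps n [down p (only (n + 1))] w i j =
      if i = p + 1 ∧ j = n + 2 then xor (w i j) (w p (n + 1)) else w i j := by
    intro w p i j
    simp only [apps, List.foldl_cons, List.foldl_nil, Cmd.app, cnotApp_apply, only]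
    by_cases hj : j = n + 2
    · subst hj; simp
    · have : 1 ≤ j → j - 1 ≠ n + 1 := by omega
      by_cases h1 : 1 ≤ j <;> simp [hj, this, h1]
  have h3 := hw 3 (by omega) (by omega) le_rfl
  have h5' := hw 5 (by omega) (by omega) (by omega)
  have h6 := hw 6 (by omega) (by omega) (by omega)
  have h7 := hw 7 (by omega) (by omega) (by omega)
  have h8 := hw 8 (by omega) (by omega) (by omega)
  have h9 := hw 9 (by omega) (by omega) (by omega)
  have h10 := hw 10 (by omega) (by omega) (by omega)
  have h11 := hw 11 (by omega) (by omega) (by omega)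
  simp only [park, apps_append]
  interval_cases i <;> simp [apps_move, *]

theorem apps_output (n : ℕ) (w : Grid) (h10 : ∀ j, w 10 j = false) (h11 : ∀ j, w 11 j = false) :
    apps n (output n) w = withOutput (fun j => full n j && w 8 j)
      (fun j => full n j && (decide (1 ≤ j) && w 9 (j - 1))) w := by
  funext i j
  simp only [apps, output, List.foldl_cons, List.foldl_nil, Cmd.app]
  by_cases h1 : i = 10
  · subst h1
    by_cases hj : 1 ≤ j ∧ full n (j - 1) = true <;> by_cases hj' : full n j = true <;>
      simp [cnotApp_apply, withOutput, hj, hj', h10]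
  · by_cases h2 : i = 11
    · subst h2
      by_cases hj' : full n j = true
      · by_cases hj : 1 ≤ j
        · have : full n (j - 1) = true := by rw [full_iff] at *; omega
          simp [cnotApp_apply, withOutput, hj, hj', this, h10, h11]
        · simp [cnotApp_apply, withOutput, hj, hj', h10, h11]
      · simp [cnotApp_apply, withOutput, hj', h11]
    · by_cases h3 : i = 9
      · subst h3
        by_cases hj' : full n j = true <;> simp [cnotApp_apply, withOutput, hj']
      · simp [cnotApp_apply, withOutput, h1, h2, h3]

/-! ### Arithmetic of the four layers -/

theorem csa_sum_testBit (x y z j : ℕ) :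
    (csa x y z).1.testBit j = par3 (x.testBit j) (y.testBit j) (z.testBit j) := by
  simp [csa, par3]

theorem csa_carry_testBit (x y z j : ℕ) :
    (csa x y z).2.testBit j = (decide (1 ≤ j) &&
      maj3 (x.testBit (j - 1)) (y.testBit (j - 1)) (z.testBit (j - 1))) := by
  cases j with
  | zero => simp [csa]
  | succ j => simp [csa, maj3, Nat.testBit_succ]

theorem csa_add (x y z : ℕ) : (csa x y z).1 + (csa x y z).2 = x + y + z := by
  suffices H : ∀ k x y z : ℕ, x < 2 ^ k → y < 2 ^ k → z < 2 ^ k →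
      (csa x y z).1 + (csa x y z).2 = x + y + z by
    have hlt : ∀ {a}, a ≤ x + y + z → a < 2 ^ (x + y + z) := fun h =>
      h.trans_lt Nat.lt_two_pow_self
    exact H (x + y + z) x y z (hlt (by omega)) (hlt (by omega)) (hlt (by omega))
  intro k
  induction k with
  | zero =>
    intro x y z hx hy hz
    obtain rfl : x = 0 := by simpa using hx
    obtain rfl : y = 0 := by simpa using hy
    obtain rfl : z = 0 := by simpa using hz
    rfl
  | succ k ih =>
    intro x y z hx hy hz
    have h := ih (x / 2) (y / 2) (z / 2) (by omega) (by omega) (by omega)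
    have h1 : (csa x y z).1 / 2 = (csa (x / 2) (y / 2) (z / 2)).1 := by
      simp [csa, Nat.xor_div_two]
    have h2 : (csa x y z).2 / 2 / 2 = (csa (x / 2) (y / 2) (z / 2)).2 / 2 := by
      simp [csa, Nat.and_div_two, Nat.or_div_two]
    have h3 : 2 ∣ (csa (x / 2) (y / 2) (z / 2)).2 := by simp [csa]
    have h4 : 2 ∣ (csa x y z).2 := by simp [csa]
    have b : ∀ a i : ℕ, (a.testBit i).toNat = a / 2 ^ i % 2 := Nat.toNat_testBit
    have h5 := b (csa x y z).1 0
    have h6 := b (csa x y z).2 1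
    rw [csa_sum_testBit] at h5
    rw [csa_carry_testBit] at h6
    have bx := b x 0
    have by' := b y 0
    have bz := b z 0
    simp only [le_refl, decide_true, Bool.true_and, Nat.sub_self, pow_zero, pow_one,
      Nat.div_one] at h5 h6 bx by' bz
    revert h5 h6 bx by' bz
    cases x.testBit 0 <;> cases y.testBit 0 <;> cases z.testBit 0 <;>
      simp only [par3, maj3, Bool.toNat_true, Bool.toNat_false, Bool.xor_false, Bool.xor_true,
        Bool.not_false, Bool.not_true, Bool.and_true, Bool.and_false, Bool.or_false,
        Bool.or_true] <;> omega

theorem testBit_bit_mul (x i k j : ℕ) :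
    (bit x i * k).testBit j = (x.testBit i && k.testBit j) := by
  rw [bit]
  cases x.testBit i <;> simp

theorem testBit_of_le {x k : ℕ} (hx : x < 2 ^ k) {j : ℕ} (hj : k ≤ j) : x.testBit j = false :=
  Nat.testBit_lt_two_pow (hx.trans_le (Nat.pow_le_pow_right (by norm_num) hj))

theorem layer1_fst_testBit (a b c j : ℕ) : (layer1 a b c).1.testBit j =
    par3 (a.testBit j) (b.testBit j) (c.testBit j) := csa_sum_testBit a b c j

theorem layer1_snd_testBit (a b c j : ℕ) : (layer1 a b c).2.testBit j = (decide (1 ≤ j) &&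
    maj3 (a.testBit (j - 1)) (b.testBit (j - 1)) (c.testBit (j - 1))) :=
  csa_carry_testBit a b c j

section

variable (n m a b c j : ℕ)

theorem layer2_fst_testBit : (layer2 n m a b c).1.testBit j =
    par3 (decide (j < n + 1) && (layer1 a b c).1.testBit j)
      (decide (j < n + 1) && (layer1 a b c).2.testBit j)
      ((layer1 a b c).2.testBit (n + 1) && (2 ^ (n + 1) % m).testBit j) := by
  rw [layer2, csa_sum_testBit, Nat.testBit_mod_two_pow, Nat.testBit_mod_two_pow, testBit_bit_mul]

theorem layer2_snd_testBit : (layer2 n m a b c).2.testBit j = (decide (1 ≤ j) &&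
    maj3 (decide (j - 1 < n + 1) && (layer1 a b c).1.testBit (j - 1))
      (decide (j - 1 < n + 1) && (layer1 a b c).2.testBit (j - 1))
      ((layer1 a b c).2.testBit (n + 1) && (2 ^ (n + 1) % m).testBit (j - 1))) := by
  rw [layer2, csa_carry_testBit, Nat.testBit_mod_two_pow, Nat.testBit_mod_two_pow,
    testBit_bit_mul]

theorem layer3_fst_testBit : (layer3 n m a b c).1.testBit j =
    par3 ((layer2 n m a b c).1.testBit j) ((layer2 n m a b c).2.testBit j)
      ((layer1 a b c).1.testBit (n + 1) && (2 ^ (n + 1) % m).testBit j) := by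
  rw [layer3, csa_sum_testBit, testBit_bit_mul]

theorem layer3_snd_testBit : (layer3 n m a b c).2.testBit j = (decide (1 ≤ j) &&
    maj3 ((layer2 n m a b c).1.testBit (j - 1)) ((layer2 n m a b c).2.testBit (j - 1))
      ((layer1 a b c).1.testBit (n + 1) && (2 ^ (n + 1) % m).testBit (j - 1))) := by
  rw [layer3, csa_carry_testBit, testBit_bit_mul]

theorem layer4_fst_testBit : (layer4 n m a b c).1.testBit j =
    par3 ((layer3 n m a b c).1.testBit j) ((layer3 n m a b c).2.testBit j)
      ((layer1 a b c).2.testBit (n + 2) && (2 ^ (n + 2) % m).testBit j) := by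
  rw [layer4, csa_sum_testBit, testBit_bit_mul]

theorem layer4_snd_testBit : (layer4 n m a b c).2.testBit j = (decide (1 ≤ j) &&
    maj3 ((layer3 n m a b c).1.testBit (j - 1)) ((layer3 n m a b c).2.testBit (j - 1))
      ((layer1 a b c).2.testBit (n + 2) && (2 ^ (n + 2) % m).testBit (j - 1))) := by
  rw [layer4, csa_carry_testBit, testBit_bit_mul]

end

section

variable {n m a b c : ℕ}

theorem residue_testBit (hm : 0 < m) (hmn : m < 2 ^ n) (k : ℕ) {j : ℕ} (hj : n ≤ j) :
    (2 ^ k % m).testBit j = false :=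
  testBit_of_le ((Nat.mod_lt _ hm).trans hmn) hj

theorem layer1_fst_lt (ha : a < 2 ^ (n + 2)) (hb : b < 2 ^ (n + 2)) (hc : c < 2 ^ (n + 2)) :
    (layer1 a b c).1 < 2 ^ (n + 2) := by
  refine Nat.lt_pow_two_of_testBit _ fun j hj => ?_
  rw [layer1_fst_testBit, testBit_of_le ha hj, testBit_of_le hb hj, testBit_of_le hc hj]
  rfl

theorem layer1_snd_lt (ha : a < 2 ^ (n + 2)) (hb : b < 2 ^ (n + 2)) (hc : c < 2 ^ (n + 2)) :
    (layer1 a b c).2 < 2 ^ (n + 3) := by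
  refine Nat.lt_pow_two_of_testBit _ fun j hj => ?_
  have hj' : n + 2 ≤ j - 1 := by omega
  rw [layer1_snd_testBit, testBit_of_le ha hj', testBit_of_le hb hj', testBit_of_le hc hj']
  simp [maj3]

/-- The first two layers after the overflow bits have been dropped: one bit shorter. -/
theorem layer2_fst_lt (hm : 0 < m) (hmn : m < 2 ^ n) : (layer2 n m a b c).1 < 2 ^ (n + 1) := by
  refine Nat.lt_pow_two_of_testBit _ fun j hj => ?_
  rw [layer2_fst_testBit, residue_testBit hm hmn _ (by omega : n ≤ j)]
  have : ¬j < n + 1 := by omega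
  simp [this, par3]

theorem layer2_snd_lt (hm : 0 < m) (hmn : m < 2 ^ n) : (layer2 n m a b c).2 < 2 ^ (n + 2) := by
  refine Nat.lt_pow_two_of_testBit _ fun j hj => ?_
  rw [layer2_snd_testBit, residue_testBit hm hmn _ (by omega : n ≤ j - 1)]
  have : ¬j - 1 < n + 1 := by omega
  simp [this, maj3]

theorem layer3_fst_lt (hm : 0 < m) (hmn : m < 2 ^ n) : (layer3 n m a b c).1 < 2 ^ (n + 2) := by
  refine Nat.lt_pow_two_of_testBit _ fun j hj => ?_
  rw [layer3_fst_testBit, residue_testBit hm hmn _ (by omega : n ≤ j),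
    testBit_of_le (layer2_fst_lt hm hmn) (by omega : n + 1 ≤ j),
    testBit_of_le (layer2_snd_lt hm hmn) hj]
  simp [par3]

theorem layer3_snd_lt (hm : 0 < m) (hmn : m < 2 ^ n) : (layer3 n m a b c).2 < 2 ^ (n + 2) := by
  refine Nat.lt_pow_two_of_testBit _ fun j hj => ?_
  rw [layer3_snd_testBit, residue_testBit hm hmn _ (by omega : n ≤ j - 1),
    testBit_of_le (layer2_fst_lt hm hmn) (by omega : n + 1 ≤ j - 1)]
  simp [maj3]

theorem layer4_fst_lt (hm : 0 < m) (hmn : m < 2 ^ n) : (layer4 n m a b c).1 < 2 ^ (n + 2) := by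
  refine Nat.lt_pow_two_of_testBit _ fun j hj => ?_
  rw [layer4_fst_testBit, residue_testBit hm hmn _ (by omega : n ≤ j),
    testBit_of_le (layer3_fst_lt hm hmn) hj, testBit_of_le (layer3_snd_lt hm hmn) hj]
  simp [par3]

/-- The bits `n + 1` of the two words of the third layer are not both set. The added residues
vanish at the positions `n` and `n + 1`, so the first of these bits is the conjunction of the bits
`n` of the two words of the first layer, and the second implies that those bits differ. -/
theorem layer3_testBit_and (hm : 0 < m) (hmn : m < 2 ^ n) :
    ((layer3 n m a b c).1.testBit (n + 1) && (layer3 n m a b c).2.testBit (n + 1)) = false := by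
  rw [layer3_fst_testBit, layer3_snd_testBit, Nat.add_sub_cancel,
    residue_testBit hm hmn _ (by omega : n ≤ n + 1), residue_testBit hm hmn _ le_rfl,
    testBit_of_le (layer2_fst_lt hm hmn) le_rfl, layer2_snd_testBit, Nat.add_sub_cancel,
    layer2_fst_testBit, residue_testBit hm hmn _ le_rfl]
  simp only [Nat.lt_succ_self, decide_true, Bool.true_and, Bool.and_false, par3, maj3]
  cases (layer1 a b c).1.testBit n <;> cases (layer1 a b c).2.testBit n <;> simp

theorem layer4_snd_lt (hm : 0 < m) (hmn : m < 2 ^ n) : (layer4 n m a b c).2 < 2 ^ (n + 2) := by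
  refine Nat.lt_pow_two_of_testBit _ fun j hj => ?_
  rw [layer4_snd_testBit, residue_testBit hm hmn _ (by omega : n ≤ j - 1)]
  rcases Nat.eq_or_lt_of_le hj with rfl | hj
  · have := layer3_testBit_and (a := a) (b := b) (c := c) hm hmn
    have e : n + 2 - 1 = n + 1 := rfl
    rw [e, maj3, this]
    simp
  · rw [testBit_of_le (layer3_fst_lt hm hmn) (by omega : n + 2 ≤ j - 1)]
    simp [maj3]

theorem even_layer4_snd : Even (layer4 n m a b c).2 := even_two_mul _

theorem eq_low_add_bit {x k : ℕ} (hx : x < 2 ^ (k + 1)) :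
    x = x % 2 ^ k + bit x k * 2 ^ k := by
  rw [bit, Nat.toNat_testBit, Nat.mod_eq_of_lt (Nat.div_lt_of_lt_mul (by rwa [← pow_succ])),
    mul_comm, Nat.mod_add_div]

theorem layer4_modEq (ha : a < 2 ^ (n + 2)) (hb : b < 2 ^ (n + 2)) (hc : c < 2 ^ (n + 2)) :
    (layer4 n m a b c).1 + (layer4 n m a b c).2 ≡ a + b + c [MOD m] := by
  have h1 : (layer1 a b c).1 + (layer1 a b c).2 = a + b + c := csa_add a b c
  have hu := eq_low_add_bit (layer1_fst_lt ha hb hc)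
  have hv := eq_low_add_bit (layer1_snd_lt ha hb hc)
  have hv' := eq_low_add_bit (Nat.mod_lt (layer1 a b c).2 (show 0 < 2 ^ (n + 1 + 1) by positivity))
  have hbit : bit ((layer1 a b c).2 % 2 ^ (n + 1 + 1)) (n + 1) = bit (layer1 a b c).2 (n + 1) := by
    simp [bit, Nat.testBit_mod_two_pow]
  rw [hbit, Nat.mod_mod_of_dvd _ (pow_dvd_pow 2 (Nat.le_succ (n + 1)))] at hv'
  rw [layer4, csa_add, layer3, csa_add, layer2, csa_add, ← h1]
  have hres : ∀ d k : ℕ, d * (2 ^ k % m) ≡ d * 2 ^ k [MOD m] := fun d k =>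
    (Nat.mod_modEq _ _).mul_left d
  refine ((((Nat.ModEq.refl _).add (hres _ _)).add (hres _ _)).add (hres _ _)).trans ?_
  refine congrArg (· % m) ?_
  have hv'' : (layer1 a b c).2 % 2 ^ (n + 2) = (layer1 a b c).2 % 2 ^ (n + 1) +
      bit (layer1 a b c).2 (n + 1) * 2 ^ (n + 1) := hv'
  have hu' : (layer1 a b c).1 = (layer1 a b c).1 % 2 ^ (n + 1) +
      bit (layer1 a b c).1 (n + 1) * 2 ^ (n + 1) := hu
  have hv3 : (layer1 a b c).2 = (layer1 a b c).2 % 2 ^ (n + 2) +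
      bit (layer1 a b c).2 (n + 2) * 2 ^ (n + 2) := hv
  omega

end

/-! ### Invariants of the computation -/

/-- The contents between two layers: words `x` and `y` in the rows `r` and `r + 1`, nothing in the
rows below them, and in column `n + 2`, from row `e` on, the parked bits `p`. -/
structure Stage (n r e : ℕ) (x y p : ℕ → Bool) (w : Grid) : Prop where
  fst : ∀ j < n + 2, w r j = x j
  snd : ∀ j < n + 2, w (r + 1) j = y j
  zero : ∀ i, r + 2 ≤ i → i < 12 → ∀ j < n + 2, w i j = false
  edge : ∀ i, e ≤ i → i < 12 → w i (n + 2) = p i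

/-- One layer: the residue `K`, controlled on the parked bit of row `r + 3`, is loaded and added
to the words `x` and `y` on the columns `S`. -/
theorem Stage.add {n r : ℕ} {x y p : ℕ → Bool} {w : Grid} (h : Stage n r (r + 3) x y p w)
    (hr : r + 3 < 12) {S K : ℕ → Bool} (hS : ∀ j, S j = true → j < n + 2)
    (hK : ∀ j, K j = true → S j = true) :
    Stage n (r + 2) (r + 4) (fun j => S j && par3 (x j) (y j) (p (r + 3) && K j))
      (fun j => S j && maj3 (x j) (y j) (p (r + 3) && K j)) p
      (apps n (.load (r + 2) K :: adder r S) w) := by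
  have hload : ∀ i j, (Cmd.load (r + 2) K).app n w i j =
      if i = r + 2 ∧ K j = true then xor (w i j) (p (r + 3)) else w i j := by
    intro i j
    have := h.edge (r + 3) le_rfl hr
    simp only [Cmd.app, Nat.add_assoc, this]
  have h2 : ∀ j < n + 2, (Cmd.load (r + 2) K).app n w (r + 2) j = (p (r + 3) && K j) := by
    intro j hj
    rw [hload, h.zero _ le_rfl (by omega) j hj]
    cases K j <;> simp
  refine ⟨fun j hj => ?_, fun j hj => ?_, fun i hi hi' j hj => ?_, fun i hi hi' => ?_⟩
  · rw [apps_cons, apps_adder, h2 j hj, hload, hload, hload]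
    cases hSj : S j
    · have : K j = false := by
        cases hKj : K j
        · rfl
        · rw [hK j hKj] at hSj; cases hSj
      simp [this]
    · simp [h.fst j hj, h.snd j hj]
  · rw [show r + 2 + 1 = r + 3 from rfl, apps_cons, apps_adder, h2 j hj, hload, hload, hload]
    have h3 := h.zero (r + 3) (by omega) hr j hj
    cases S j <;> simp [h3, h.fst j hj, h.snd j hj]
  · rw [apps_cons, apps_adder, if_neg (by omega : ¬i = r + 1), if_neg (by omega : ¬i = r + 2),
      if_neg (by omega : ¬i = r + 3), ite_self, hload, if_neg (by omega)]
    exact h.zero i (by omega) hi' j hj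
  · have hn : ¬S (n + 2) = true := fun h => by have := hS _ h; omega
    rw [apps_cons, apps_adder, if_neg hn, hload, if_neg (by omega)]
    exact h.edge i (by omega) hi'

/-- The carry word of a layer is shifted by one column. -/
theorem Stage.shift {n r : ℕ} {x y p : ℕ → Bool} {w : Grid}
    (h : Stage n (r + 2) (r + 4) x y p w) (hr : r + 4 < 12) (hp : p (r + 4) = false) :
    Stage n (r + 2) (r + 5) x (fun j => decide (1 ≤ j) && y (j - 1)) p
      (apps n (carry n r ++ settle n r) w) := by
  have hc4 : ∀ j < n + 2, apps n (carry n r) w (r + 4) j = (decide (1 ≤ j) && y (j - 1)) := by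
    intro j hj
    have h0 := h.zero (r + 4) le_rfl hr j hj
    rw [apps_carry]
    by_cases h1 : 1 ≤ j
    · have := h.snd (j - 1) (by omega)
      rw [show r + 2 + 1 = r + 3 from rfl] at this
      rw [if_pos ⟨rfl, h1, by omega⟩, h0, this]
      simp [h1]
    · rw [if_neg (by omega), if_neg (by omega), h0]
      simp [h1]
  have hc3 : ∀ j < n + 2, apps n (carry n r) w (r + 3) j = false := by
    intro j hj
    rw [apps_carry, if_neg (by omega), if_pos ⟨rfl, hj⟩]
    by_cases h1 : j + 1 < n + 2
    · exact h.zero (r + 4) le_rfl hr _ h1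
    · rw [show j + 1 = n + 2 by omega, h.edge (r + 4) le_rfl hr, hp]
  have hc : ∀ i j, i ≠ r + 3 → i ≠ r + 4 → apps n (carry n r ++ settle n r) w i j = w i j := by
    intro i j h3 h4
    rw [apps_append, apps_settle, if_neg fun h => h3 h.1, if_neg fun h => h4 h.1, apps_carry,
      if_neg fun h => h4 h.1, if_neg fun h => h3 h.1]
  refine ⟨fun j hj => ?_, fun j hj => ?_, fun i hi hi' j hj => ?_, fun i hi hi' => ?_⟩
  · rw [hc _ _ (by omega) (by omega), h.fst j hj]
  · rw [show r + 2 + 1 = r + 3 from rfl, apps_append, apps_settle, if_pos ⟨rfl, hj⟩, hc3 j hj,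
      hc4 j hj, Bool.false_xor]
  · by_cases h4 : i = r + 4
    · rw [h4, apps_append, apps_settle, if_neg (by omega), if_pos ⟨rfl, hj⟩, hc3 j hj]
    · rw [hc _ _ (by omega) h4, h.zero i (by omega) hi' j hj]
  · rw [hc _ _ (by omega) (by omega), h.edge i (by omega) hi']

/-- The contents with words in the input rows 0, 1, 2 and the output rows 10, 11. -/
def contents (a b c x y : ℕ) : Grid := fun i k =>
  if i = 0 then a.testBit k else if i = 1 then b.testBit k else if i = 2 then c.testBit k
  else if i = 10 then x.testBit k else if i = 11 then y.testBit k else false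

/-- The parked overflow bits: bit `n + 1` of `v`, bit `n + 1` of `u` and bit `n + 2` of `v`. -/
def parked (n u v : ℕ) : ℕ → Bool := fun i =>
  if i = 5 then v.testBit (n + 1) else if i = 7 then u.testBit (n + 1)
  else if i = 9 then v.testBit (n + 2) else false

/-- The first layer. -/
def addInputs (n : ℕ) : List Cmd := adder 0 (full n) ++ carry n 0

section

variable {n a b c : ℕ}

theorem apps_addInputs (ha : a < 2 ^ (n + 2)) (hb : b < 2 ^ (n + 2)) (hc : c < 2 ^ (n + 2)) :
    (∀ j, apps n (addInputs n) (contents a b c 0 0) 2 j = (layer1 a b c).1.testBit j) ∧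
    (∀ j < n + 3, apps n (addInputs n) (contents a b c 0 0) 4 j = (layer1 a b c).2.testBit j) ∧
    (∀ i j, i ≠ 0 → i ≠ 1 → i ≠ 2 → i ≠ 4 →
      apps n (addInputs n) (contents a b c 0 0) i j = false) := by
  have hA : ∀ i j, i ≠ 0 → i ≠ 1 → apps n (adder 0 (full n)) (contents a b c 0 0) i j =
      if i = 2 then (layer1 a b c).1.testBit j
      else if i = 3 then full n j && (layer1 a b c).2.testBit (j + 1)
      else false := by
    intro i j h0 h1
    rw [apps_adder, layer1_fst_testBit, layer1_snd_testBit]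
    by_cases hj : full n j = true
    · by_cases h2 : i = 2
      · simp [hj, h2, contents]
      · by_cases h3 : i = 3 <;> simp [hj, h0, h1, h2, h3, contents]
    · have hj' : n + 2 ≤ j := by rw [full_iff] at hj; omega
      rw [testBit_of_le ha hj', testBit_of_le hb hj', testBit_of_le hc hj']
      by_cases h2 : i = 2
      · simp [hj, h2, contents, par3, testBit_of_le hc hj']
      · by_cases h3 : i = 3 <;> simp [hj, h0, h1, h2, h3, contents]
  simp only [addInputs, apps_append]
  refine ⟨fun j => ?_, fun j hj => ?_, fun i j h0 h1 h2 h4 => ?_⟩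
  · rw [apps_carry, if_neg (by omega), if_neg (by omega), hA _ _ (by omega) (by omega), if_pos rfl]
  · rw [apps_carry]
    by_cases h1 : 1 ≤ j
    · have : full n (j - 1) = true := full_iff.2 (by omega)
      rw [if_pos ⟨rfl, h1, hj⟩, hA _ _ (by omega) (by omega), hA _ _ (by omega) (by omega),
        Nat.sub_add_cancel h1, this]
      simp
    · obtain rfl : j = 0 := by omega
      rw [if_neg (by omega), if_neg (by omega), hA _ _ (by omega) (by omega),
        show (layer1 a b c).2.testBit 0 = false by rw [layer1_snd_testBit]; rfl]
      simp
  · rw [apps_carry, if_neg (by omega)]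
    split_ifs with h3
    · rw [hA _ _ (by omega) (by omega)]
      simp
    · rw [hA _ _ h0 h1]
      by_cases h3' : i = 3
      · have : full n j = false := by
          rw [← Bool.not_eq_true, full_iff]; omega
        simp [h3', this]
      · simp [h2, h3']

/-- After the first layer and the parking of the overflow bits. -/
theorem stage_addInputs (ha : a < 2 ^ (n + 2)) (hb : b < 2 ^ (n + 2)) (hc : c < 2 ^ (n + 2)) :
    Stage n 2 5 (layer1 a b c).1.testBit (layer1 a b c).2.testBit
      (parked n (layer1 a b c).1 (layer1 a b c).2)
      (apps n (addInputs n ++ park n ++ settle n 0) (contents a b c 0 0)) := by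
  obtain ⟨h2, h4, h0⟩ := apps_addInputs ha hb hc
  simp only [apps_append]
  have hs : ∀ w i j, i ≠ 3 → i ≠ 4 → apps n (settle n 0) w i j = w i j := by
    intro w i j h3 h4
    rw [apps_settle, if_neg fun h => h3 h.1, if_neg fun h => h4 h.1]
  refine ⟨fun j hj => ?_, fun j hj => ?_, fun i hi hi' j hj => ?_, fun i hi hi' => ?_⟩
  · rw [hs _ _ _ (by omega) (by omega), apps_park_left _ _ _ _ hj, h2]
  · rw [apps_settle, if_pos ⟨rfl, hj⟩, apps_park_left _ _ _ _ hj, apps_park_left _ _ _ _ hj,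
      h0 _ _ (by omega) (by omega) (by omega) (by omega), h4 j (by omega), Bool.false_xor]
  · by_cases hi4 : i = 4
    · rw [hi4, apps_settle, if_neg (by omega), if_pos ⟨rfl, hj⟩, apps_park_left _ _ _ _ hj,
        h0 _ _ (by omega) (by omega) (by omega) (by omega)]
    · rw [hs _ _ _ (by omega) hi4, apps_park_left _ _ _ _ hj,
        h0 _ _ (by omega) (by omega) (by omega) (by omega)]
  · rw [hs _ _ _ (by omega) (by omega), apps_park_right n _ (fun i _ h4 h3 =>
      h0 _ _ (by omega) (by omega) (by omega) h4) i hi hi', h4 _ (by omega), h4 _ (by omega), h2,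
      parked]

end

/-! ### The forward computation -/

/-- The second layer. The mask leaves out column `n + 1`, which truncates both words of the first
layer. -/
def addCarry (n m : ℕ) : List Cmd :=
  .load 4 (2 ^ (n + 1) % m).testBit :: adder 2 (body n) ++ (carry n 2 ++ settle n 2)

/-- The third layer. -/
def addSum (n m : ℕ) : List Cmd :=
  .load 6 (2 ^ (n + 1) % m).testBit :: adder 4 (full n) ++ (carry n 4 ++ settle n 4)

/-- The fourth layer. -/
def addTop (n m : ℕ) : List Cmd :=
  .load 8 (2 ^ (n + 2) % m).testBit :: adder 6 (full n)

section

variable {n m a b c : ℕ}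

theorem Stage.congr {n r e : ℕ} {x x' y y' p : ℕ → Bool} {w : Grid} (h : Stage n r e x y p w)
    (hx : ∀ j < n + 2, x j = x' j) (hy : ∀ j < n + 2, y j = y' j) : Stage n r e x' y' p w :=
  ⟨fun j hj => (h.fst j hj).trans (hx j hj), fun j hj => (h.snd j hj).trans (hy j hj), h.zero,
    h.edge⟩

theorem residue_lt (hm : 0 < m) (hmn : m < 2 ^ n) (k : ℕ) {j : ℕ}
    (hj : (2 ^ k % m).testBit j = true) : j < n := by
  by_contra! h
  rw [residue_testBit hm hmn k h] at hj
  cases hj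

theorem stage_addCarry (hm : 0 < m) (hmn : m < 2 ^ n) {w : Grid}
    (h : Stage n 2 5 (layer1 a b c).1.testBit (layer1 a b c).2.testBit
      (parked n (layer1 a b c).1 (layer1 a b c).2) w) :
    Stage n 4 7 (layer2 n m a b c).1.testBit (layer2 n m a b c).2.testBit
      (parked n (layer1 a b c).1 (layer1 a b c).2) (apps n (addCarry n m) w) := by
  have hb : ∀ j, body n j = decide (j < n + 1) := fun j => rfl
  have h1 := (h.add (by omega) (S := body n) (K := (2 ^ (n + 1) % m).testBit)
    (fun j hj => by have : j < n + 1 := by simpa [body] using hj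
                    omega)
    (fun j hj => by have := residue_lt hm hmn _ hj
                    simp [body]; omega)).shift (by omega) rfl
  rw [addCarry, apps_append]
  have hp : parked n (layer1 a b c).1 (layer1 a b c).2 (2 + 3) =
    (layer1 a b c).2.testBit (n + 1) := rfl
  have hres : ∀ j, ¬j < n + 1 → (2 ^ (n + 1) % m).testBit j = false := fun j hj =>
    residue_testBit hm hmn _ (by omega)
  refine h1.congr (fun j _ => ?_) fun j _ => ?_
  · rw [layer2_fst_testBit, hp, hb]
    by_cases hj : j < n + 1
    · simp [hj]
    · simp [hj, hres j hj, par3]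
  · rw [layer2_snd_testBit, hp, hb]
    by_cases hj : j - 1 < n + 1
    · simp [hj]
    · simp [hj, maj3]

theorem stage_addSum (hm : 0 < m) (hmn : m < 2 ^ n) {w : Grid}
    (h : Stage n 4 7 (layer2 n m a b c).1.testBit (layer2 n m a b c).2.testBit
      (parked n (layer1 a b c).1 (layer1 a b c).2) w) :
    Stage n 6 9 (layer3 n m a b c).1.testBit (layer3 n m a b c).2.testBit
      (parked n (layer1 a b c).1 (layer1 a b c).2) (apps n (addSum n m) w) := by
  have h1 := (h.add (by omega) (S := full n) (K := (2 ^ (n + 1) % m).testBit)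
    (fun j hj => full_iff.1 hj)
    (fun j hj => full_iff.2 (by have := residue_lt hm hmn _ hj; omega))).shift (by omega) rfl
  rw [addSum, apps_append]
  have hp : parked n (layer1 a b c).1 (layer1 a b c).2 (4 + 3) =
    (layer1 a b c).1.testBit (n + 1) := rfl
  refine h1.congr (fun j hj => ?_) fun j hj => ?_
  · rw [layer3_fst_testBit, hp, full_iff.2 hj, Bool.true_and]
  · have : full n (j - 1) = true := full_iff.2 (by omega)
    rw [layer3_snd_testBit, hp, this, Bool.true_and]

theorem apps_addTop (hm : 0 < m) (hmn : m < 2 ^ n) {w : Grid}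
    (h : Stage n 6 9 (layer3 n m a b c).1.testBit (layer3 n m a b c).2.testBit
      (parked n (layer1 a b c).1 (layer1 a b c).2) w) :
    (∀ j < n + 2, apps n (addTop n m) w 8 j = (layer4 n m a b c).1.testBit j) ∧
    (∀ j < n + 2, apps n (addTop n m) w 9 j = (layer4 n m a b c).2.testBit (j + 1)) := by
  have h1 := h.add (by omega) (S := full n) (K := (2 ^ (n + 2) % m).testBit)
    (fun j hj => full_iff.1 hj)
    (fun j hj => full_iff.2 (by have := residue_lt hm hmn _ hj; omega))
  have hp : parked n (layer1 a b c).1 (layer1 a b c).2 (6 + 3) =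
    (layer1 a b c).2.testBit (n + 2) := rfl
  refine ⟨fun j hj => (h1.fst j hj).trans ?_, fun j hj => (h1.snd j hj).trans ?_⟩
  · rw [layer4_fst_testBit, hp, full_iff.2 hj, Bool.true_and]
  · rw [layer4_snd_testBit, hp, full_iff.2 hj, Bool.true_and]
    simp

end

/-! ### The whole circuit -/

/-- The second layer, preceded by the parking of the overflow bits. -/
def parkAndAdd (n m : ℕ) : List Cmd := park n ++ settle n 0 ++ addCarry n m

/-- The four layers. -/
def forward (n m : ℕ) : List Cmd :=
  addInputs n ++ parkAndAdd n m ++ addSum n m ++ addTop n m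

/-- The four layers, a copy of their result, and the removal of everything else. -/
def program (n m : ℕ) : List Cmd := forward n m ++ output n ++ undo (forward n m)

theorem totalLen_program (n m : ℕ) : totalLen (program n m) = 316 := by
  simp [totalLen, program, forward, addInputs, parkAndAdd, addCarry, addSum, addTop, adder, carry,
    settle, park, move, output, undo, Cmd.inv, Cmd.len]

section

variable {n m : ℕ}

theorem low_valid_cnot {p q d e : ℕ} {S : ℕ → Bool} (hp : p < 10) (hq : q < 10)
    (h : q = p + 1 ∧ d = 0 ∧ e ≤ 1 ∨ p = q + 1 ∧ e = 0 ∧ d ≤ 1)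
    (hS : ∀ j, S j = true → j < n + 3) :
    (Cmd.cnot p q d e S).Low ∧ (Cmd.cnot p q d e S).Valid n :=
  ⟨⟨hp, hq, by omega⟩, by omega, by omega, h, hS⟩

theorem low_valid_adder {r : ℕ} {S : ℕ → Bool} (hr : r + 3 < 10)
    (hS : ∀ j, S j = true → j < n + 3) : ∀ c ∈ adder r S, c.Low ∧ c.Valid n := by
  have htof : (Cmd.tof (r + 1) S).Low ∧ (Cmd.tof (r + 1) S).Valid n :=
    ⟨hr, by omega, hS⟩
  simp only [adder, List.forall_mem_cons, List.not_mem_nil, false_imp_iff, implies_true, and_true]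
  refine ⟨?_, ?_, ?_, ?_, htof, ?_, ?_, ?_, ?_⟩ <;>
    exact low_valid_cnot (by omega) (by omega) (by omega) hS

theorem low_valid_carry_settle {r : ℕ} (hr : r + 4 < 10) :
    ∀ c ∈ carry n r ++ settle n r, c.Low ∧ c.Valid n := by
  simp only [carry, settle, List.cons_append, List.nil_append, List.forall_mem_cons,
    List.not_mem_nil, false_imp_iff, implies_true, and_true]
  refine ⟨?_, ?_, ?_, ?_⟩ <;> exact low_valid_cnot (by omega) (by omega) (by omega) full_lt

theorem low_valid_park : ∀ c ∈ park n, c.Low ∧ c.Valid n := by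
  have hS : ∀ {c}, c < n + 3 → ∀ j, only c j = true → j < n + 3 := by
    intro c hc j hj
    have : j = c := by simpa [only] using hj
    omega
  simp only [park, move, List.cons_append, List.nil_append, List.forall_mem_cons,
    List.not_mem_nil, false_imp_iff, implies_true, and_true]
  refine ⟨?_, ?_, ?_, ?_, ?_, ?_, ?_, ?_, ?_, ?_, ?_, ?_, ?_, ?_, ?_, ?_, ?_, ?_, ?_, ?_⟩ <;>
    exact low_valid_cnot (by omega) (by omega) (by omega) (hS (by omega))

theorem low_valid_load (hm : 0 < m) (hmn : m < 2 ^ n) {z : ℕ} (hz : z + 1 < 10) (k : ℕ) :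
    (Cmd.load z (2 ^ k % m).testBit).Low ∧ (Cmd.load z (2 ^ k % m).testBit).Valid n :=
  ⟨hz, by omega, fun j hj => by have := residue_lt hm hmn k hj; omega⟩

theorem low_valid_forward (hm : 0 < m) (hmn : m < 2 ^ n) :
    ∀ c ∈ forward n m, c.Low ∧ c.Valid n := by
  have hbody : ∀ j, body n j = true → j < n + 3 := by
    intro j hj
    have : j < n + 1 := by simpa [body] using hj
    omega
  have h0 := List.forall_mem_append.1 (low_valid_carry_settle (n := n) (r := 0) (by omega))
  have h1 : ∀ c ∈ addInputs n, c.Low ∧ c.Valid n :=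
    List.forall_mem_append.2 ⟨low_valid_adder (by omega) full_lt, h0.1⟩
  have h2 : ∀ c ∈ addCarry n m, c.Low ∧ c.Valid n :=
    List.forall_mem_append.2 ⟨List.forall_mem_cons.2 ⟨low_valid_load hm hmn (by omega) _,
      low_valid_adder (by omega) hbody⟩, low_valid_carry_settle (by omega)⟩
  have h3 : ∀ c ∈ addSum n m, c.Low ∧ c.Valid n :=
    List.forall_mem_append.2 ⟨List.forall_mem_cons.2 ⟨low_valid_load hm hmn (by omega) _,
      low_valid_adder (by omega) full_lt⟩, low_valid_carry_settle (by omega)⟩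
  have h4 : ∀ c ∈ addTop n m, c.Low ∧ c.Valid n :=
    List.forall_mem_cons.2 ⟨low_valid_load hm hmn (by omega) _,
      low_valid_adder (by omega) full_lt⟩
  simp only [forward, parkAndAdd, List.forall_mem_append (l₁ := addInputs n ++ _ ++ _),
    List.forall_mem_append (l₁ := addInputs n ++ _), List.forall_mem_append (l₁ := addInputs n),
    List.forall_mem_append (l₁ := park n ++ _), List.forall_mem_append (l₁ := park n)]
  exact ⟨⟨⟨h1, ⟨low_valid_park, h0.2⟩, h2⟩, h3⟩, h4⟩

theorem valid_output : ∀ c ∈ output n, c.Valid n := by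
  simp only [output, List.forall_mem_cons, List.not_mem_nil, false_imp_iff, implies_true, and_true]
  refine ⟨?_, ?_, ?_, ?_, ?_, ?_, ?_⟩ <;>
    exact ⟨by omega, by omega, by omega, full_lt⟩

theorem valid_program (hm : 0 < m) (hmn : m < 2 ^ n) : ∀ c ∈ program n m, c.Valid n := by
  have h : ∀ c ∈ forward n m, c.Valid n := fun c hc => (low_valid_forward hm hmn c hc).2
  simp only [program, List.forall_mem_append]
  exact ⟨⟨h, valid_output⟩, undo_valid h⟩

/-- Lists of commands that have their effect on all contents, as CNOT and Toffoli gates do. -/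
theorem pres_of_forall {cs : List Cmd} (h : ∀ c ∈ cs, ∀ w, c.Pre n w) : ∀ w, Pres n cs w := by
  induction cs with
  | nil => intro w; trivial
  | cons c cs ih =>
    intro w
    exact ⟨h c List.mem_cons_self w, ih (fun d hd => h d (List.mem_cons_of_mem _ hd)) _⟩

theorem pres_adder (r : ℕ) (S : ℕ → Bool) (w : Grid) : Pres n (adder r S) w :=
  pres_of_forall (by simp [adder, Cmd.Pre]) w

theorem pres_carry (r : ℕ) (w : Grid) : Pres n (carry n r) w :=
  pres_of_forall (by simp [carry, Cmd.Pre]) w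

theorem pres_settle (r : ℕ) (w : Grid) : Pres n (settle n r) w :=
  pres_of_forall (by simp [settle, Cmd.Pre]) w

theorem pres_park (w : Grid) : Pres n (park n) w :=
  pres_of_forall (by simp [park, move, Cmd.Pre]) w

theorem pres_output (w : Grid) : Pres n (output n) w :=
  pres_of_forall (by simp [output, Cmd.Pre]) w

theorem Stage.pres_load {r e : ℕ} {x y p : ℕ → Bool} {w : Grid} (h : Stage n r e x y p w)
    (hr : r + 3 < 12) (S : ℕ → Bool) : (Cmd.load (r + 2) S).Pre n w := fun j hj =>
  ⟨h.zero _ le_rfl (by omega) j hj, h.zero _ (by omega) hr j hj⟩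

variable {a b c : ℕ}

/-- The contents after each of the four layers and after the copy of the result. -/
structure Trace (n m a b c : ℕ) : Prop where
  pres : Pres n (forward n m) (contents a b c 0 0)
  stage2 : Stage n 4 7 (layer2 n m a b c).1.testBit (layer2 n m a b c).2.testBit
    (parked n (layer1 a b c).1 (layer1 a b c).2)
    (apps n (addInputs n ++ parkAndAdd n m) (contents a b c 0 0))
  stage3 : Stage n 6 9 (layer3 n m a b c).1.testBit (layer3 n m a b c).2.testBit
    (parked n (layer1 a b c).1 (layer1 a b c).2)
    (apps n (addInputs n ++ parkAndAdd n m ++ addSum n m) (contents a b c 0 0))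
  output : apps n (forward n m ++ output n) (contents a b c 0 0) =
    withOutput (layer4 n m a b c).1.testBit (layer4 n m a b c).2.testBit
      (apps n (forward n m) (contents a b c 0 0))

theorem trace (hm : 0 < m) (hmn : m < 2 ^ n) (ha : a < 2 ^ (n + 2)) (hb : b < 2 ^ (n + 2))
    (hc : c < 2 ^ (n + 2)) : Trace n m a b c := by
  have h1 := stage_addInputs ha hb hc
  have h2 := stage_addCarry hm hmn h1
  have h3 := stage_addSum hm hmn h2
  have h4 := apps_addTop hm hmn h3
  have e2 : apps n (addInputs n ++ parkAndAdd n m) (contents a b c 0 0) =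
      apps n (addCarry n m) (apps n (addInputs n ++ park n ++ settle n 0)
        (contents a b c 0 0)) := by
    simp only [parkAndAdd, apps_append]
  have e3 : apps n (addInputs n ++ parkAndAdd n m ++ addSum n m) (contents a b c 0 0) =
      apps n (addSum n m) (apps n (addInputs n ++ parkAndAdd n m) (contents a b c 0 0)) :=
    apps_append _ _ _ _
  have e4 : apps n (forward n m) (contents a b c 0 0) = apps n (addTop n m)
      (apps n (addInputs n ++ parkAndAdd n m ++ addSum n m) (contents a b c 0 0)) :=
    apps_append _ _ _ _
  rw [← e2] at h2 h3 h4
  rw [← e3] at h3 h4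
  rw [← e4] at h4
  refine ⟨?_, h2, h3, ?_⟩
  · rw [forward, pres_append, pres_append, pres_append]
    refine ⟨⟨⟨?_, ?_⟩, ?_⟩, ?_⟩
    · rw [addInputs, pres_append]
      exact ⟨pres_adder _ _ _, pres_carry _ _⟩
    · rw [parkAndAdd, pres_append, pres_append, addCarry, pres_append, pres_append]
      simp only [apps_append] at h1 ⊢
      exact ⟨⟨pres_park _, pres_settle _ _⟩, ⟨h1.pres_load (by omega) _, pres_adder _ _ _⟩,
        pres_carry _ _, pres_settle _ _⟩
    · rw [addSum, pres_append, pres_append]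
      exact ⟨⟨h2.pres_load (by omega) _, pres_adder _ _ _⟩, pres_carry _ _, pres_settle _ _⟩
    · exact ⟨h3.pres_load (by omega) _, pres_adder _ _ _⟩
  · have hlow : ∀ c ∈ forward n m, c.Low := fun c hc => (low_valid_forward hm hmn c hc).1
    rw [apps_append, apps_output]
    · congr 1
      · funext j
        by_cases hj : full n j = true
        · rw [hj, Bool.true_and, h4.1 j (full_iff.1 hj)]
        · rw [testBit_of_le (layer4_fst_lt hm hmn) (by rw [full_iff] at hj; omega)]
          simp [hj]
      · funext j
        by_cases hj : full n j = true
        · rw [hj, Bool.true_and]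
          by_cases h1j : 1 ≤ j
          · have := full_iff.1 hj
            rw [h4.2 (j - 1) (by omega), Nat.sub_add_cancel h1j]
            simp [h1j]
          · rw [layer4_snd_testBit]
            simp [h1j]
        · rw [testBit_of_le (layer4_snd_lt hm hmn) (by rw [full_iff] at hj; omega)]
          simp [hj]
    · intro j
      rw [apps_of_le hlow _ (by omega)]
      simp [contents]
    · intro j
      rw [apps_of_le hlow _ (by omega)]
      simp [contents]

theorem withOutput_contents (x y : ℕ) :
    withOutput x.testBit y.testBit (contents a b c 0 0) = contents a b c x y := by
  funext i k
  simp only [withOutput, contents]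
  by_cases h10 : i = 10
  · simp [h10]
  · by_cases h11 : i = 11 <;> simp [h10, h11]

/-- The circuit restores the input and leaves nothing but the two output words. -/
theorem apps_program (hm : 0 < m) (hmn : m < 2 ^ n) (ha : a < 2 ^ (n + 2))
    (hb : b < 2 ^ (n + 2)) (hc : c < 2 ^ (n + 2)) :
    Pres n (program n m) (contents a b c 0 0) ∧
      apps n (program n m) (contents a b c 0 0) =
        contents a b c (layer4 n m a b c).1 (layer4 n m a b c).2 := by
  have h := trace hm hmn ha hb hc
  have hu := undo_apps (layer4 n m a b c).1.testBit (layer4 n m a b c).2.testBit (forward n m)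
    (fun d hd => (low_valid_forward hm hmn d hd).1) (fun d hd => (low_valid_forward hm hmn d hd).2)
    (contents a b c 0 0) h.pres
  rw [← h.output, withOutput_contents] at hu
  rw [program, pres_append, pres_append, apps_append n _ (undo (forward n m)), and_assoc]
  exact And.intro (And.intro h.pres (pres_output (apps n (forward n m) (contents a b c 0 0)))) hu

end

/-! ### Registers -/

/-- The rows of the five registers. -/
def registerRow : Fin 5 → ℕ := ![0, 1, 2, 10, 11]

theorem registerRow_lt (k : Fin 5) : registerRow k < 12 := by
  fin_cases k <;> simp [registerRow]

theorem registerRow_injective : Function.Injective registerRow := by decide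

/-- The input and output registers. -/
def register (n : ℕ) : Fin 5 × Fin (n + 2) ↪ Site n where
  toFun x := site n (registerRow x.1) x.2
  inj' x y h := by
    rw [site_inj (registerRow_lt _) (by omega) (registerRow_lt _) (by omega)] at h
    exact Prod.ext (registerRow_injective h.1) (Fin.ext h.2)

theorem load_register {n a b c x y : ℕ} (ha : a < 2 ^ (n + 2)) (hb : b < 2 ^ (n + 2))
    (hc : c < 2 ^ (n + 2)) (hx : x < 2 ^ (n + 2)) (hy : y < 2 ^ (n + 2)) :
    load (register n) ![a, b, c, x, y] = display n (contents a b c x y) := by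
  have hrow : ∀ (k : Fin 5) (j : ℕ), contents a b c x y (registerRow k) j =
      (![a, b, c, x, y] k).testBit j := by
    intro k j
    fin_cases k <;> simp [registerRow, contents]
  have hlt : ∀ k : Fin 5, ![a, b, c, x, y] k < 2 ^ (n + 2) := by
    intro k
    fin_cases k <;> simpa
  funext v
  rw [load, Bool.eq_iff_iff]
  simp only [decide_eq_true_iff]
  constructor
  · rintro ⟨k, i, rfl, h⟩
    change display n _ (site n (registerRow k) i) = true
    rw [display_site _ (registerRow_lt k) (by omega), hrow, h]
  · intro h
    have hk : ∃ k, registerRow k = v.1 := by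
      by_contra! hne
      have h0 := hne 0
      have h1 := hne 1
      have h2 := hne 2
      have h3 := hne 3
      have h4 := hne 4
      simp only [registerRow, Matrix.cons_val] at h0 h1 h2 h3 h4
      simp [display, contents, h0.symm, h1.symm, h2.symm, h3.symm, h4.symm] at h
    obtain ⟨k, hk⟩ := hk
    rw [display, ← hk, hrow] at h
    have hj : (v.2 : ℕ) < n + 2 := by
      by_contra! hj
      rw [testBit_of_le (hlt k) hj] at h
      cases h
    refine ⟨k, ⟨v.2, hj⟩, ?_, h⟩
    exact ((site_eq_iff (registerRow_lt k) (by omega) v).2 ⟨hk.symm, rfl⟩).symm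

/-- Two registers in the rows `p` and `q`. -/
def registerPair (n p q : ℕ) {k l : ℕ} (hp : p < 12) (hq : q < 12) (hpq : p ≠ q)
    (hk : k ≤ n + 4) (hl : l ≤ n + 4) : Fin k ⊕ Fin l ↪ Site n where
  toFun x := Sum.elim (fun i : Fin k => site n p i.val) (fun i : Fin l => site n q i.val) x
  inj' x y h := by
    rcases x with x | x <;> rcases y with y | y <;> simp only [Sum.elim_inl, Sum.elim_inr] at h
    · rw [site_inj hp (by omega) hp (by omega)] at h
      rw [Fin.ext h.2]
    · rw [site_inj hp (by omega) hq (by omega)] at h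
      exact absurd h.1 hpq
    · rw [site_inj hq (by omega) hp (by omega)] at h
      exact absurd h.1.symm hpq
    · rw [site_inj hq (by omega) hq (by omega)] at h
      rw [Fin.ext h.2]

theorem holds_registerPair {n p q k l : ℕ} (hp : p < 12) (hq : q < 12) (hpq : p ≠ q)
    (hk : k ≤ n + 4) (hl : l ≤ n + 4) (x : ℕ × ℕ) (α : ℂ) (w : Grid)
    (h1 : ∀ j < k, w p j = x.1.testBit j) (h2 : ∀ j < l, w q j = x.2.testBit j) :
    Holds (registerPair n p q hp hq hpq hk hl) x (α • ket (display n w)) := by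
  intro y hy
  have : y = display n w := by
    by_contra hne
    simp [ket, hne] at hy
  subst this
  refine ⟨fun i => ?_, fun i => ?_⟩
  · change display n w (site n p i) = _
    rw [display_site w hp (by omega), h1 i i.2]
  · change display n w (site n q i) = _
    rw [display_site w hq (by omega), h2 i i.2]

/-- The run of the program up to the end of a prefix `cs` of it. -/
theorem run_prefix {n : ℕ} {cs ds ps : List Cmd} (e : ps = cs ++ ds)
    (hv : ∀ c ∈ ps, c.Valid n) (r : Record (Site n)) :
    ∃ α : ℂ, ∀ w, Pres n ps w →
      (circuit n ps hv).run r (ket (display n w)) (totalLen cs) =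
        α • ket (display n (apps n cs w)) := by
  subst e
  obtain ⟨α, hα⟩ := run_circuit hv r
  exact ⟨α, fun w hw => hα w ((pres_append n cs ds w).1 hw).1⟩

end CCNTC

theorem lemma1 :
    -- the arithmetic: no new overflow bit, and a carry-save encoding of the sum modulo `m`
    (∀ n m a b c : ℕ, 0 < m → m < 2 ^ n →
      a < 2 ^ (n + 2) → b < 2 ^ (n + 2) → c < 2 ^ (n + 2) →
        (CCNTC.layer1 a b c).1 < 2 ^ (n + 2) ∧ (CCNTC.layer1 a b c).2 < 2 ^ (n + 3) ∧
        (CCNTC.layer2 n m a b c).1 < 2 ^ (n + 2) ∧ (CCNTC.layer2 n m a b c).2 < 2 ^ (n + 2) ∧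
        (CCNTC.layer3 n m a b c).1 < 2 ^ (n + 2) ∧ (CCNTC.layer3 n m a b c).2 < 2 ^ (n + 2) ∧
        (CCNTC.layer4 n m a b c).1 < 2 ^ (n + 2) ∧ (CCNTC.layer4 n m a b c).2 < 2 ^ (n + 2) ∧
        Even (CCNTC.layer4 n m a b c).2 ∧
        (CCNTC.layer4 n m a b c).1 + (CCNTC.layer4 n m a b c).2 ≡ a + b + c [MOD m]) ∧
    -- the circuits, with a classical controller of polynomially bounded size
    ∃ P : Polynomial ℕ, ∀ n m : ℕ, 0 < m → m < 2 ^ n →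
      ∃ (V : Type) (_ : Fintype V) (_ : DecidableEq V) (C : CCNTC.Circuit V)
        (reg : Fin 5 × Fin (n + 2) ↪ V),
        C.depth ≤ 374 ∧
        (∀ r, C.Consistent r → C.size r ≤ 551 * n + 757) ∧
        C.width (Set.range reg) ≤ 33 * n + 47 ∧
        C.controllerSize ≤ P.eval n ∧
        -- on every branch, hence on every superposition of inputs, the circuit acts (up to a
        -- factor that does not depend on the input) as the map
        -- `|a, b, c, 0, 0⟩ ↦ |a, b, c, u, v⟩`, all other qubits being returned to `|0⟩`
        (∀ r, C.Consistent r → ∃ α : ℂ, ∀ a b c : ℕ,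
          a < 2 ^ (n + 2) → b < 2 ^ (n + 2) → c < 2 ^ (n + 2) →
            C.run r (CCNTC.ket (CCNTC.load reg ![a, b, c, 0, 0])) C.depth =
              α • CCNTC.ket (CCNTC.load reg
                ![a, b, c, (CCNTC.layer4 n m a b c).1, (CCNTC.layer4 n m a b c).2])) ∧
        -- the four layers are computed one after another
        ∃ (t₁ t₂ t₃ t₄ : ℕ) (R₁ : Fin (n + 2) ⊕ Fin (n + 3) ↪ V)
          (R₂ R₃ R₄ : Fin (n + 2) ⊕ Fin (n + 2) ↪ V),
          t₁ < t₂ ∧ t₂ < t₃ ∧ t₃ < t₄ ∧ t₄ ≤ C.depth ∧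
          ∀ r, C.Consistent r → ∀ a b c : ℕ,
            a < 2 ^ (n + 2) → b < 2 ^ (n + 2) → c < 2 ^ (n + 2) →
              CCNTC.Holds R₁ (CCNTC.layer1 a b c)
                (C.run r (CCNTC.ket (CCNTC.load reg ![a, b, c, 0, 0])) t₁) ∧
              CCNTC.Holds R₂ (CCNTC.layer2 n m a b c)
                (C.run r (CCNTC.ket (CCNTC.load reg ![a, b, c, 0, 0])) t₂) ∧
              CCNTC.Holds R₃ (CCNTC.layer3 n m a b c)
                (C.run r (CCNTC.ket (CCNTC.load reg ![a, b, c, 0, 0])) t₃) ∧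
              CCNTC.Holds R₄ (CCNTC.layer4 n m a b c)
                (C.run r (CCNTC.ket (CCNTC.load reg ![a, b, c, 0, 0])) t₄) := by
  refine ⟨fun n m a b c hm hmn ha hb hc =>
    ⟨CCNTC.layer1_fst_lt ha hb hc, CCNTC.layer1_snd_lt ha hb hc,
    (CCNTC.layer2_fst_lt hm hmn).trans_le (Nat.pow_le_pow_right two_pos (Nat.le_succ _)),
    CCNTC.layer2_snd_lt hm hmn, CCNTC.layer3_fst_lt hm hmn, CCNTC.layer3_snd_lt hm hmn,
    CCNTC.layer4_fst_lt hm hmn, CCNTC.layer4_snd_lt hm hmn, CCNTC.even_layer4_snd,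
    CCNTC.layer4_modEq ha hb hc⟩,
    316 * ((Polynomial.X + 3) * (2 * Polynomial.X + 7)), fun n m hm hmn => ?_⟩
  -- There is no positive modulus below `2 ^ 0`; the bound on the size below needs `n ≠ 0`.
  have hn : 1 ≤ n := by
    by_contra h
    obtain rfl : n = 0 := by omega
    simp at hmn
    omega
  have hv := CCNTC.valid_program hm hmn
  have hlen := CCNTC.totalLen_program n m
  have hload : ∀ {a b c : ℕ}, a < 2 ^ (n + 2) → b < 2 ^ (n + 2) → c < 2 ^ (n + 2) →
      CCNTC.load (CCNTC.register n) ![a, b, c, 0, 0] =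
        CCNTC.display n (CCNTC.contents a b c 0 0) := fun ha hb hc =>
    CCNTC.load_register ha hb hc (by positivity) (by positivity)
  -- The four layers end after the following initial parts of the program.
  have e1 : CCNTC.program n m = CCNTC.addInputs n ++ (CCNTC.parkAndAdd n m ++ CCNTC.addSum n m ++
      CCNTC.addTop n m ++ CCNTC.output n ++ CCNTC.undo (CCNTC.forward n m)) := by
    simp only [CCNTC.program, CCNTC.forward, List.append_assoc]
  have e2 : CCNTC.program n m = CCNTC.addInputs n ++ CCNTC.parkAndAdd n m ++ (CCNTC.addSum n m ++
      CCNTC.addTop n m ++ CCNTC.output n ++ CCNTC.undo (CCNTC.forward n m)) := by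
    simp only [CCNTC.program, CCNTC.forward, List.append_assoc]
  have e3 : CCNTC.program n m = CCNTC.addInputs n ++ CCNTC.parkAndAdd n m ++ CCNTC.addSum n m ++
      (CCNTC.addTop n m ++ CCNTC.output n ++ CCNTC.undo (CCNTC.forward n m)) := by
    simp only [CCNTC.program, CCNTC.forward, List.append_assoc]
  have e4 : CCNTC.program n m =
      CCNTC.forward n m ++ CCNTC.output n ++ CCNTC.undo (CCNTC.forward n m) := rfl
  refine ⟨CCNTC.Site n, inferInstance, inferInstance, CCNTC.circuit n (CCNTC.program n m) hv,
    CCNTC.register n, ?_, fun r _ => ?_, ?_, ?_, fun r _ => ?_,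
    CCNTC.totalLen (CCNTC.addInputs n),
    CCNTC.totalLen (CCNTC.addInputs n ++ CCNTC.parkAndAdd n m),
    CCNTC.totalLen (CCNTC.addInputs n ++ CCNTC.parkAndAdd n m ++ CCNTC.addSum n m),
    CCNTC.totalLen (CCNTC.forward n m ++ CCNTC.output n),
    CCNTC.registerPair n 2 4 (by omega) (by omega) (by omega) (by omega) (by omega),
    CCNTC.registerPair n 4 5 (by omega) (by omega) (by omega) (by omega) (by omega),
    CCNTC.registerPair n 6 7 (by omega) (by omega) (by omega) (by omega) (by omega),
    CCNTC.registerPair n 10 11 (by omega) (by omega) (by omega) (by omega) (by omega),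
    ?_, ?_, ?_, ?_, fun r _ a b c ha hb hc => ?_⟩
  · rw [CCNTC.depth_circuit, hlen]
    omega
  · refine (CCNTC.size_circuit_le hv r).trans ?_
    rw [hlen]
    omega
  · exact (CCNTC.width_circuit_le hv _).trans (by omega)
  · refine (CCNTC.controllerSize_circuit_le hv).trans ?_
    simp [hlen]
  · obtain ⟨α, hα⟩ := CCNTC.run_prefix (List.append_nil _).symm hv r
    refine ⟨α, fun a b c ha hb hc => ?_⟩
    have h := CCNTC.apps_program hm hmn ha hb hc
    rw [hload ha hb hc, CCNTC.depth_circuit, hα _ h.1, h.2,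
      CCNTC.load_register ha hb hc (CCNTC.layer4_fst_lt hm hmn) (CCNTC.layer4_snd_lt hm hmn)]
  · simp [CCNTC.totalLen, CCNTC.addInputs, CCNTC.parkAndAdd, CCNTC.park, CCNTC.move, CCNTC.Cmd.len]
  · simp [CCNTC.totalLen, CCNTC.addSum, CCNTC.Cmd.len]
  · simp only [CCNTC.forward, CCNTC.totalLen_append (_ ++ _ ++ CCNTC.addSum n m ++ _),
      CCNTC.totalLen_append (_ ++ _ ++ CCNTC.addSum n m)]
    simp [CCNTC.totalLen, CCNTC.output, CCNTC.Cmd.len]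
    omega
  · rw [CCNTC.depth_circuit, CCNTC.program, CCNTC.totalLen_append (_ ++ _)]
    exact Nat.le_add_right _ _
  · have hw := (CCNTC.apps_program hm hmn ha hb hc).1
    have ht := CCNTC.trace hm hmn ha hb hc
    have h1 := CCNTC.apps_addInputs ha hb hc
    obtain ⟨α₁, hα₁⟩ := CCNTC.run_prefix e1 hv r
    obtain ⟨α₂, hα₂⟩ := CCNTC.run_prefix e2 hv r
    obtain ⟨α₃, hα₃⟩ := CCNTC.run_prefix e3 hv r
    obtain ⟨α₄, hα₄⟩ := CCNTC.run_prefix e4 hv r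
    rw [hload ha hb hc, hα₁ _ hw, hα₂ _ hw, hα₃ _ hw, hα₄ _ hw]
    exact ⟨CCNTC.holds_registerPair _ _ _ _ _ _ _ _ (fun j _ => h1.1 j) h1.2.1,
      CCNTC.holds_registerPair _ _ _ _ _ _ _ _ ht.stage2.fst ht.stage2.snd,
      CCNTC.holds_registerPair _ _ _ _ _ _ _ _ ht.stage3.fst ht.stage3.snd,
      CCNTC.holds_registerPair _ _ _ _ _ _ _ _
        (fun j _ => by rw [ht.output]; simp [CCNTC.withOutput])
        (fun j _ => by rw [ht.output]; simp [CCNTC.withOutput])⟩
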